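/- Let $M$ be a smooth ($C^\infty$, Hausdorff, second countable, without boundary, not necessarily connected) $n$-manifold. Let $\Omega^j(M)$ be the space of smooth real differential $j$-forms on $M$ (with $\Omega^{-1}=0$), $d$ the exterior derivative, and $B^k(M)=d\,\Omega^{k-1}(M)$. Let $\overline{Z}^k(M)$ be the space of those closed forms $\lambda\in\Omega^k(M)$ for which there are a compact set $K\subseteq M$ and $\nu\in\Omega^{k-1}(M\setminus K)$ with $d\nu=\lambda|_{M\setminus K}$, and put $$c_k(M)=\dim_{\mathbb R}\,\overline{Z}^k(M)/B^k(M).$$ Let $k$ be an integer with $0<k\neq n$, and let $B\subset M$ be an open $n$-ball with compact closure in $M$, in the sense that there are a smooth chart $\varphi$ of $M$ and a closed Euclidean ball $\overline{D}$ of positive radius contained in the image of $\varphi$ such that $B=\varphi^{-1}(D)$, where $D$ is the interior of $\overline{D}$. Then $$c_k(M\setminus\overline{B})=c_k(M),$$ as an equality of (possibly infinite) cardinal numbers, where $M\setminus\overline B$ is regarded as an open submanifold of $M$. -/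

import Mathlib

open scoped Manifold ContDiff Topology

noncomputable section

namespace DeRham

variable {n : ℕ} {M : Type*} [TopologicalSpace M] [ChartedSpace (EuclideanSpace ℝ (Fin n)) M]

/-- A (not necessarily smooth) real-valued differential `k`-form on the `n`-manifold `M`: an
alternating `k`-linear form on each tangent space. -/
def Form (n : ℕ) (M : Type*) [TopologicalSpace M]
    [ChartedSpace (EuclideanSpace ℝ (Fin n)) M] (k : ℕ) : Type _ :=
  (x : M) → TangentSpace (𝓡 n) x [⋀^Fin k]→L[ℝ] ℝ

instance (k : ℕ) : AddCommGroup (Form n M k) :=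
  inferInstanceAs (AddCommGroup ((x : M) → TangentSpace (𝓡 n) x [⋀^Fin k]→L[ℝ] ℝ))

instance (k : ℕ) : Module ℝ (Form n M k) :=
  inferInstanceAs (Module ℝ ((x : M) → TangentSpace (𝓡 n) x [⋀^Fin k]→L[ℝ] ℝ))

/-- The expression of a form in the chart `φ` of `M` around `x₀`, that is, the pullback of `α`
by `φ⁻¹`, a form on (the target of `φ` in) `ℝⁿ`. -/
def Form.inChart {k : ℕ} (α : Form n M k) (x₀ : M) (y : EuclideanSpace ℝ (Fin n)) :
    EuclideanSpace ℝ (Fin n) [⋀^Fin k]→L[ℝ] ℝ :=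
  (α ((extChartAt (𝓡 n) x₀).symm y)).compContinuousLinearMap
    (mfderiv 𝓘(ℝ, EuclideanSpace ℝ (Fin n)) (𝓡 n) (extChartAt (𝓡 n) x₀).symm y)

/-- `α` is a smooth form on the set `s` (used for open `s` only): its expression in each chart is
`C^∞`. -/
def Form.SmoothOn {k : ℕ} (α : Form n M k) (s : Set M) : Prop :=
  ∀ x₀ : M, ContDiffOn ℝ ∞ (α.inChart x₀)
    ((extChartAt (𝓡 n) x₀).target ∩ (extChartAt (𝓡 n) x₀).symm ⁻¹' s)

/-- The exterior derivative on a manifold: at `x`, with `φ` the chart around `x`, it is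
`φ^* (d ((φ⁻¹)^* α))`, where the inner `d` is the exterior derivative on `ℝⁿ`. -/
def Form.d {k : ℕ} (α : Form n M k) : Form n M (k + 1) := fun x =>
  (extDeriv (α.inChart x) (extChartAt (𝓡 n) x x)).compContinuousLinearMap
    (mfderiv (𝓡 n) 𝓘(ℝ, EuclideanSpace ℝ (Fin n)) (extChartAt (𝓡 n) x) x)

/-- `α` restricted to the set `s` (used for open `s` only) is `dν` for some smooth form `ν` on `s`
of degree one less. There are no nonzero forms of degree `-1`, so for `k = 0` this means that `α`
vanishes on `s`. Values of `ν` outside `s` play no role. -/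
def Form.ExactOn : {k : ℕ} → Form n M k → Set M → Prop
  | 0, α, s => ∀ x ∈ s, α x = 0
  | _ + 1, α, s => ∃ ν : Form n M _, ν.SmoothOn s ∧ ∀ x ∈ s, ν.d x = α x

section helpers

variable {k : ℕ}

theorem Form.zero_apply (x : M) : (0 : Form n M k) x = 0 := rfl

theorem Form.add_apply (α η : Form n M k) (x : M) : (α + η) x = α x + η x := rfl

theorem Form.smul_apply (c : ℝ) (α : Form n M k) (x : M) : (c • α) x = c • α x := rfl

theorem Form.inChart_zero (x₀ : M) : (0 : Form n M k).inChart x₀ = 0 := by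
  rfl

theorem Form.inChart_add (α η : Form n M k) (x₀ : M) :
    (α + η).inChart x₀ = α.inChart x₀ + η.inChart x₀ := by
  rfl

theorem Form.inChart_smul (c : ℝ) (α : Form n M k) (x₀ : M) :
    (c • α).inChart x₀ = c • α.inChart x₀ := by
  rfl

theorem Form.SmoothOn.mono {α : Form n M k} {s t : Set M} (h : α.SmoothOn t) (hst : s ⊆ t) :
    α.SmoothOn s := fun x₀ =>
  (h x₀).mono (Set.inter_subset_inter_right _ (Set.preimage_mono hst))

theorem Form.SmoothOn.zero (s : Set M) : (0 : Form n M k).SmoothOn s := fun x₀ => by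
  rw [Form.inChart_zero]; exact contDiffOn_const

theorem Form.SmoothOn.add {α η : Form n M k} {s : Set M} (hα : α.SmoothOn s)
    (hη : η.SmoothOn s) : (α + η).SmoothOn s := fun x₀ => by
  rw [Form.inChart_add]; exact (hα x₀).add (hη x₀)

theorem Form.SmoothOn.smul {α : Form n M k} {s : Set M} (c : ℝ) (hα : α.SmoothOn s) :
    (c • α).SmoothOn s := fun x₀ => by
  rw [Form.inChart_smul]; exact (hα x₀).const_smul c

theorem Form.SmoothOn.differentiableAt {α : Form n M k} {s : Set M} (hs : IsOpen s)
    (hα : α.SmoothOn s) {x : M} (hx : x ∈ s) :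
    DifferentiableAt ℝ (α.inChart x) (extChartAt (𝓡 n) x x) := by
  refine ((hα x).contDiffAt ?_).differentiableAt (by simp)
  refine Filter.inter_mem (extChartAt_target_mem_nhds x) ?_
  refine (continuousAt_extChartAt_symm x).preimage_mem_nhds ?_
  rw [extChartAt_to_inv]
  exact hs.mem_nhds hx

theorem Form.d_add {α η : Form n M k} {s : Set M} (hs : IsOpen s) (hα : α.SmoothOn s)
    (hη : η.SmoothOn s) {x : M} (hx : x ∈ s) : (α + η).d x = α.d x + η.d x := by
  simp only [Form.d, Form.inChart_add]
  rw [extDeriv_add (hα.differentiableAt hs hx) (hη.differentiableAt hs hx)]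
  rfl

theorem Form.d_smul (c : ℝ) (α : Form n M k) : (c • α).d = c • α.d := by
  funext x
  simp only [Form.d, Form.inChart_smul]
  rw [extDeriv_smul]
  rfl

theorem Form.d_zero : (0 : Form n M k).d = 0 := by
  have h := Form.d_smul (0 : ℝ) (0 : Form n M k)
  rwa [zero_smul, zero_smul] at h

theorem Form.ExactOn.mono {α : Form n M k} {s t : Set M} (h : α.ExactOn t) (hst : s ⊆ t) :
    α.ExactOn s := by
  cases k with
  | zero => exact fun x hx => h x (hst hx)
  | succ k => obtain ⟨ν, hν, hd⟩ := h; exact ⟨ν, hν.mono hst, fun x hx => hd x (hst hx)⟩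

theorem Form.ExactOn.zero (s : Set M) : (0 : Form n M k).ExactOn s := by
  cases k with
  | zero => exact fun _ _ => rfl
  | succ k => exact ⟨0, .zero s, fun x _ => by rw [Form.d_zero]⟩

theorem Form.ExactOn.add {α η : Form n M k} {s : Set M} (hs : IsOpen s) (hα : α.ExactOn s)
    (hη : η.ExactOn s) : (α + η).ExactOn s := by
  cases k with
  | zero => exact fun x hx => by rw [Form.add_apply, hα x hx, hη x hx, add_zero]
  | succ k =>
    obtain ⟨ν, hν, hd⟩ := hα
    obtain ⟨μ, hμ, he⟩ := hη
    exact ⟨ν + μ, hν.add hμ, fun x hx => by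
      rw [Form.d_add hs hν hμ hx, hd x hx, he x hx, Form.add_apply]⟩

theorem Form.ExactOn.smul {α : Form n M k} {s : Set M} (c : ℝ) (hα : α.ExactOn s) :
    (c • α).ExactOn s := by
  cases k with
  | zero => exact fun x hx => by rw [Form.smul_apply, hα x hx, smul_zero]
  | succ k =>
    obtain ⟨ν, hν, hd⟩ := hα
    exact ⟨c • ν, hν.smul c, fun x hx => by
      rw [Form.d_smul, Form.smul_apply, hd x hx, Form.smul_apply]⟩

end helpers

/-- `Ω^k(M)`: the smooth `k`-forms on `M`. -/
def smoothForms (n : ℕ) (M : Type*) [TopologicalSpace M]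
    [ChartedSpace (EuclideanSpace ℝ (Fin n)) M] (k : ℕ) : Submodule ℝ (Form n M k) where
  carrier := {α | α.SmoothOn Set.univ}
  zero_mem' := .zero _
  add_mem' := .add
  smul_mem' c _ h := h.smul c

/-- `Z^k(M)`: the closed smooth `k`-forms on `M`. -/
def closedForms (n : ℕ) (M : Type*) [TopologicalSpace M]
    [ChartedSpace (EuclideanSpace ℝ (Fin n)) M] (k : ℕ) : Submodule ℝ (Form n M k) where
  carrier := {α | α ∈ smoothForms n M k ∧ α.d = 0}
  zero_mem' := ⟨zero_mem _, Form.d_zero⟩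
  add_mem' {α η} h h' := ⟨add_mem h.1 h'.1, by
    funext x
    rw [Form.d_add isOpen_univ h.1 h'.1 (Set.mem_univ x), h.2, h'.2]
    exact add_zero _⟩
  smul_mem' c α h := ⟨Submodule.smul_mem _ c h.1, by rw [Form.d_smul, h.2, smul_zero]⟩

/-- `B^k(M)`: the exact `k`-forms on `M`, i.e. the image of `d : Ω^{k-1}(M) → Ω^k(M)`
(the zero space for `k = 0`). -/
def exactForms (n : ℕ) (M : Type*) [TopologicalSpace M]
    [ChartedSpace (EuclideanSpace ℝ (Fin n)) M] (k : ℕ) : Submodule ℝ (Form n M k) where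
  carrier := {α | α.ExactOn Set.univ}
  zero_mem' := .zero _
  add_mem' := .add isOpen_univ
  smul_mem' c _ h := h.smul c

/-- The closed `k`-forms on `M` that are exact outside some compact set. -/
def closedFormsExactAtInfinity (n : ℕ) (M : Type*) [TopologicalSpace M] [T2Space M]
    [ChartedSpace (EuclideanSpace ℝ (Fin n)) M] (k : ℕ) : Submodule ℝ (Form n M k) where
  carrier := {α | α ∈ closedForms n M k ∧ ∃ K : Set M, IsCompact K ∧ α.ExactOn Kᶜ}
  zero_mem' := ⟨zero_mem _, ∅, isCompact_empty, .zero _⟩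
  add_mem' := by
    rintro α η ⟨hα, K, hK, h⟩ ⟨hη, L, hL, h'⟩
    refine ⟨add_mem hα hη, K ∪ L, hK.union hL, ?_⟩
    exact (h.mono (Set.compl_subset_compl.2 Set.subset_union_left)).add
      (hK.union hL).isClosed.isOpen_compl
      (h'.mono (Set.compl_subset_compl.2 Set.subset_union_right))
  smul_mem' c α h := by
    obtain ⟨hα, K, hK, h⟩ := h
    exact ⟨Submodule.smul_mem _ c hα, K, hK, h.smul c⟩

/-- `c_k(M)`: the dimension of the space of closed `k`-forms that are exact outside a compact set,
modulo the exact forms. -/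
def c (n : ℕ) (M : Type*) [TopologicalSpace M] [T2Space M]
    [ChartedSpace (EuclideanSpace ℝ (Fin n)) M] (k : ℕ) : Cardinal :=
  Module.rank ℝ (closedFormsExactAtInfinity n M k ⧸
    (exactForms n M k).submoduleOf (closedFormsExactAtInfinity n M k))

/-- `B` is an open `n`-ball in `M` (with compact closure in `M`): in some smooth chart of `M` it
is a Euclidean open ball whose closed ball is contained in the image of the chart. -/
def IsBall (n : ℕ) {M : Type*} [TopologicalSpace M]
    [ChartedSpace (EuclideanSpace ℝ (Fin n)) M] (B : Set M) : Prop :=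
  ∃ φ ∈ IsManifold.maximalAtlas (𝓡 n) ∞ M, ∃ (p : EuclideanSpace ℝ (Fin n)) (r : ℝ),
    0 < r ∧ Metric.closedBall p r ⊆ φ.target ∧ B = φ.symm '' Metric.ball p r

end DeRham

end

/-!
Let `U = M \ K` with `K` a compact subset of the domain of a chart onto `ℝⁿ`; a ball sits inside a
slightly larger one, which is diffeomorphic to `ℝⁿ`. Restriction of forms induces an isomorphism
`Z̄ᵏ(M) / Bᵏ(M) → Z̄ᵏ(U) / Bᵏ(U)` for `0 < k < n`.

* Restriction is well defined since a closed form is exact near `K` by the Poincaré lemma, so that a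
  form which is exact off a compact set is exact off a compact set disjoint from `K`.
* It is surjective: if `α = dν` on `U` off a compact set, multiply `ν` by a cutoff which is `1` near
  `K`; then `α - d(χν)` extends by zero across `K`.
* It is injective: if `α = dν` on `U`, then `α - d((1 - χ)ν)` is closed with compact support in the
  chart, hence exact because `H_cᵏ(ℝⁿ) = 0` for `k < n`. The last fact is proved by
  integrating along one coordinate axis after another, each step making the primitive vanish
  outside a slab in one more coordinate.
-/

noncomputable section

namespace DeRham

section Smoothness

variable {X E F G : Type*} [NormedAddCommGroup X] [NormedSpace ℝ X]
  [NormedAddCommGroup E] [NormedSpace ℝ E] [NormedAddCommGroup F] [NormedSpace ℝ F]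
  [NormedAddCommGroup G] [NormedSpace ℝ G] {ι : Type*} [Fintype ι]

theorem continuous_alternatization [DecidableEq ι] : Continuous
    (ContinuousMultilinearMap.alternatization (R := ℝ) (M := E) (N := G) (ι := ι)) :=
  ContinuousAlternatingMap.isEmbedding_toContinuousMultilinearMap.continuous_iff.2 <|
    continuous_finsetSum _ fun σ _ =>
      (ContinuousMultilinearMap.domDomCongrₗᵢ ℝ E G σ).continuous.const_smul _

theorem alternatization_toContinuousMultilinearMap [DecidableEq ι] (f : E [⋀^ι]→L[ℝ] G) :
    ContinuousMultilinearMap.alternatization f.toContinuousMultilinearMap =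
      (Fintype.card ι).factorial • f :=
  ContinuousAlternatingMap.toAlternatingMap_injective <| by
    rw [ContinuousMultilinearMap.alternatization_apply_toAlternatingMap]
    exact AlternatingMap.coe_alternatization f.toAlternatingMap

/- Alternatization is, up to the factor `(card ι)!`, a continuous linear retraction of the space of
multilinear maps onto the space of alternating ones. -/
theorem contDiffAt_of_toContinuousMultilinearMap {m : ℕ∞ω} {f : X → E [⋀^ι]→L[ℝ] G} {x : X}
    (h : ContDiffAt ℝ m (fun x => (f x).toContinuousMultilinearMap) x) : ContDiffAt ℝ m f x := by
  classical
  let alt : ContinuousMultilinearMap ℝ (fun _ : ι => E) G →L[ℝ] E [⋀^ι]→L[ℝ] G :=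
    ContinuousMultilinearMap.alternatization.toRealLinearMap continuous_alternatization
  have hf : f = fun x =>
      ((Fintype.card ι).factorial : ℝ)⁻¹ • alt (f x).toContinuousMultilinearMap := by
    funext x
    have halt : alt (f x).toContinuousMultilinearMap = (Fintype.card ι).factorial • f x :=
      alternatization_toContinuousMultilinearMap (f x)
    rw [halt, ← Nat.cast_smul_eq_nsmul ℝ, inv_smul_smul₀ (by positivity)]
  rw [hf]
  exact (alt.contDiff.contDiffAt.comp x h).const_smul _

theorem contDiffAt_compContinuousLinearMap {m : ℕ∞ω} {f : X → F [⋀^ι]→L[ℝ] G}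
    {A : X → E →L[ℝ] F} {x : X} (hf : ContDiffAt ℝ m f x) (hA : ContDiffAt ℝ m A x) :
    ContDiffAt ℝ m (fun x => (f x).compContinuousLinearMap (A x)) x := by
  have hpre : ContDiffAt ℝ m (fun x =>
      ContinuousMultilinearMap.compContinuousLinearMapContinuousMultilinear ℝ
        (fun _ : ι => E) (fun _ : ι => F) G fun _ => A x) x :=
    (ContinuousMultilinearMap.contDiff _).contDiffAt.comp x (contDiffAt_pi.2 fun _ => hA)
  have hval : ContDiffAt ℝ m (fun x => (f x).toContinuousMultilinearMap) x :=
    (ContinuousAlternatingMap.toContinuousMultilinearMapLI (𝕜 := ℝ) (E := F) (F := G)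
      (ι := ι)).contDiff.contDiffAt.comp x hf
  exact contDiffAt_of_toContinuousMultilinearMap (hpre.clm_apply hval)

theorem contDiffAt_extDeriv {k : ℕ} {α : E → E [⋀^Fin k]→L[ℝ] G} {x : E}
    (h : ContDiffAt ℝ ∞ α x) : ContDiffAt ℝ ∞ (extDeriv α) x :=
  ContDiffAt.comp x
    (g := fun D => ContinuousAlternatingMap.alternatizeUncurryFinCLM (n := k) ℝ E G D)
    (ContinuousLinearMap.contDiff _).contDiffAt (h.fderiv_right (m := ∞) (by simp))

theorem contDiff_extDeriv {k : ℕ} {α : E → E [⋀^Fin k]→L[ℝ] G}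
    (h : ContDiff ℝ ∞ α) : ContDiff ℝ ∞ (extDeriv α) :=
  contDiff_iff_contDiffAt.2 fun _ => contDiffAt_extDeriv h.contDiffAt

theorem extDeriv_eq_zero_of_eventually {k : ℕ} {α : E → E [⋀^Fin k]→L[ℝ] G} {x : E}
    (h : ∀ᶠ y in 𝓝 x, α y = 0) : extDeriv α x = 0 := by
  have hα : α =ᶠ[𝓝 x] (0 : ℝ) • 0 := h.mono fun y hy => by simp [hy]
  rw [hα.extDeriv_eq, extDeriv_smul, zero_smul]

theorem extDeriv_sub {k : ℕ} {α β : E → E [⋀^Fin k]→L[ℝ] G} {x : E} (hα : DifferentiableAt ℝ α x)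
    (hβ : DifferentiableAt ℝ β x) : extDeriv (α - β) x = extDeriv α x - extDeriv β x := by
  rw [sub_eq_add_neg, ← neg_one_smul ℝ β, extDeriv_add hα (hβ.const_smul (-1 : ℝ)), extDeriv_smul,
    neg_one_smul, sub_eq_add_neg]

theorem two_le_infty : minSmoothness ℝ 2 ≤ (∞ : ℕ∞ω) := by
  simp only [minSmoothness_of_isRCLikeNormedField]
  exact WithTop.coe_le_coe.2 le_top

theorem eq_of_extDeriv_eq_zero {α : E → E [⋀^Fin 0]→L[ℝ] G} (hα : Differentiable ℝ α)
    (hd : extDeriv α = 0) (x y : E) : α x = α y := by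
  let e := ContinuousAlternatingMap.constOfIsEmptyLIE ℝ E G (Fin 0)
  have hfd : ∀ z, fderiv ℝ (e.symm ∘ α) z = 0 := fun z => by
    have h := extDeriv_constOfIsEmpty (𝕜 := ℝ) (e.symm ∘ α) z
    have h' : (fun z => ContinuousAlternatingMap.constOfIsEmpty ℝ E (Fin 0) ((e.symm ∘ α) z)) = α :=
      funext fun z => e.apply_symm_apply (α z)
    rw [h', hd] at h
    exact (ContinuousAlternatingMap.ofSubsingleton ℝ E G (0 : Fin 1)).injective (h.symm.trans rfl)
  exact e.symm.injective
    (is_const_of_fderiv_eq_zero (e.symm.differentiable.comp hα) hfd x y)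

end Smoothness

section ParametricIntegral

variable {E G : Type*} [NormedAddCommGroup E] [NormedSpace ℝ E] [FiniteDimensional ℝ E]
  [NormedAddCommGroup G] [NormedSpace ℝ G]

theorem hasFDerivAt_integral_of_contDiff {H : ℝ × E → G} (hH : ContDiff ℝ 1 H) (a b : ℝ) (x : E) :
    HasFDerivAt (fun x => ∫ t in a..b, H (t, x))
      (∫ t in a..b, (fderiv ℝ H (t, x)).comp (ContinuousLinearMap.inr ℝ ℝ E)) x := by
  have hc : Continuous fun p : ℝ × E => (fderiv ℝ H p).comp (ContinuousLinearMap.inr ℝ ℝ E) :=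
    (hH.continuous_fderiv (by simp)).clm_comp continuous_const
  have hslice (y : E) : Continuous fun t : ℝ => (t, y) := by fun_prop
  obtain ⟨C, hC⟩ := ((isCompact_uIcc (a := a) (b := b)).prod
    (isCompact_closedBall x 1)).exists_bound_of_continuousOn hc.continuousOn
  refine intervalIntegral.hasFDerivAt_integral_of_dominated_of_fderiv_le
    (F' := fun x t => (fderiv ℝ H (t, x)).comp (ContinuousLinearMap.inr ℝ ℝ E))
    (bound := fun _ => C) (Metric.closedBall_mem_nhds x one_pos)
    (.of_forall fun y => (hH.continuous.comp (hslice y)).aestronglyMeasurable)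
    ((hH.continuous.comp (hslice x)).intervalIntegrable _ _)
    (hc.comp (hslice x)).aestronglyMeasurable
    (.of_forall fun t ht y hy => hC (t, y) ⟨Set.uIoc_subset_uIcc ht, hy⟩)
    intervalIntegrable_const (.of_forall fun t _ y _ => ?_)
  exact (hH.differentiable (by simp) (t, y)).hasFDerivAt.comp y (hasFDerivAt_prodMk_right t y)

theorem fderiv_integral_apply {H : ℝ × E → G} (hH : ContDiff ℝ 1 H) (a b : ℝ) (x v : E) :
    fderiv ℝ (fun x => ∫ t in a..b, H (t, x)) x v = ∫ t in a..b, fderiv ℝ H (t, x) (0, v) := by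
  rw [(hasFDerivAt_integral_of_contDiff hH a b x).fderiv,
    ContinuousLinearMap.intervalIntegral_apply]
  · rfl
  · exact (((hH.continuous_fderiv (by simp)).comp (by fun_prop)).clm_comp
      continuous_const).intervalIntegrable _ _

theorem contDiff_integral {H : ℝ × E → G} (hH : ContDiff ℝ ∞ H) (a b : ℝ) :
    ContDiff ℝ ∞ fun x => ∫ t in a..b, H (t, x) := by
  rw [contDiff_infty]
  intro m
  induction m generalizing H with
  | zero =>
    rw [Nat.cast_zero, contDiff_zero]
    exact continuous_iff_continuousAt.2 fun x =>
      (hasFDerivAt_integral_of_contDiff (hH.of_le (by exact_mod_cast le_top)) a b x).continuousAt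
  | succ m ih =>
    have hH₁ : ContDiff ℝ 1 H := hH.of_le (by exact_mod_cast le_top)
    push_cast
    rw [contDiff_succ_iff_fderiv_apply]
    refine ⟨fun x => (hasFDerivAt_integral_of_contDiff hH₁ a b x).differentiableAt, by simp,
      fun v => ?_⟩
    simp only [fderiv_integral_apply hH₁]
    exact ih (H := fun p => fderiv ℝ H p (0, v))
      ((hH.fderiv_right (m := ∞) (by simp)).clm_apply contDiff_const)

end ParametricIntegral

section Homotopy

open ContinuousAlternatingMap

variable {E F G : Type*} [NormedAddCommGroup E] [NormedSpace ℝ E]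
  [NormedAddCommGroup F] [NormedSpace ℝ F] [NormedAddCommGroup G] [NormedSpace ℝ G] {k : ℕ}

/-- The restriction of an alternating form on `ℝ × E` to the slice `{0} × E`. -/
def sliceRestriction (E G : Type*) [NormedAddCommGroup E] [NormedSpace ℝ E]
    [NormedAddCommGroup G] [NormedSpace ℝ G] (k : ℕ) :
    ((ℝ × E) [⋀^Fin k]→L[ℝ] G) →L[ℝ] E [⋀^Fin k]→L[ℝ] G :=
  compContinuousLinearMapCLM (ContinuousLinearMap.inr ℝ ℝ E)

/-- The contraction with `∂/∂t` of an alternating form on `ℝ × E`, restricted to the slice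
`{0} × E`. -/
def timeContraction (E G : Type*) [NormedAddCommGroup E] [NormedSpace ℝ E]
    [NormedAddCommGroup G] [NormedSpace ℝ G] (k : ℕ) :
    ((ℝ × E) [⋀^Fin (k + 1)]→L[ℝ] G) →L[ℝ] E [⋀^Fin k]→L[ℝ] G :=
  (sliceRestriction E G k).comp
    ((ContinuousLinearMap.apply ℝ _ ((1 : ℝ), (0 : E))).comp
      (curryLeftLI (𝕜 := ℝ) (E := ℝ × E) (F := G) (n := k)).toContinuousLinearMap)

theorem sliceRestriction_apply (f : (ℝ × E) [⋀^Fin k]→L[ℝ] G) (v : Fin k → E) :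
    sliceRestriction E G k f v = f fun i => (0, v i) := rfl

theorem timeContraction_apply (f : (ℝ × E) [⋀^Fin (k + 1)]→L[ℝ] G) (v : Fin k → E) :
    timeContraction E G k f v = f (Matrix.vecCons (1, 0) fun i => (0, v i)) := rfl

/- Cartan's formula `d ι = ∂/∂t - ι d`, at the level of first derivatives. -/
theorem alternatizeUncurryFin_timeContraction
    (D : (ℝ × E) →L[ℝ] (ℝ × E) [⋀^Fin (k + 1)]→L[ℝ] G) :
    alternatizeUncurryFin (((timeContraction E G k).comp D).comp
        (ContinuousLinearMap.inr ℝ ℝ E)) =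
      sliceRestriction E G (k + 1) (D (1, 0)) -
        timeContraction E G (k + 1) (alternatizeUncurryFin D) := by
  ext v
  have hhead : Fin.removeNth 0 (Matrix.vecCons ((1 : ℝ), (0 : E)) fun i => ((0 : ℝ), v i)) =
      fun i => ((0 : ℝ), v i) := by
    funext i; simp [Fin.removeNth]
  have htail (i : Fin (k + 1)) : Fin.removeNth i.succ
      (Matrix.vecCons ((1 : ℝ), (0 : E)) fun i => ((0 : ℝ), v i)) =
      Matrix.vecCons ((1 : ℝ), (0 : E)) fun j => ((0 : ℝ), i.removeNth v j) := by
    funext j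
    refine Fin.cases ?_ (fun j => ?_) j <;> simp [Fin.removeNth]
  rw [ContinuousAlternatingMap.sub_apply, timeContraction_apply, sliceRestriction_apply,
    eq_sub_iff_add_eq', alternatizeUncurryFin_apply (v := Matrix.vecCons _ _), Fin.sum_univ_succ,
    alternatizeUncurryFin_apply, add_assoc]
  simp only [Fin.val_zero, pow_zero, one_smul, Matrix.cons_val_zero, Fin.val_succ,
    Matrix.cons_val_succ, hhead, htail, ContinuousLinearMap.comp_apply,
    ContinuousLinearMap.inr_apply, timeContraction_apply, ← Finset.sum_add_distrib]
  simp [pow_succ]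

/-- Integration of a form on `ℝ × E` along the fibres of `ℝ × E → E`, between `a` and `b`. -/
def fiberIntegral (a b : ℝ) (Φ : ℝ × E → (ℝ × E) [⋀^Fin (k + 1)]→L[ℝ] G) (x : E) :
    E [⋀^Fin k]→L[ℝ] G :=
  ∫ t in a..b, timeContraction E G k (Φ (t, x))

theorem fiberIntegral_zero (a b : ℝ) :
    fiberIntegral a b (0 : ℝ × E → (ℝ × E) [⋀^Fin (k + 1)]→L[ℝ] G) = 0 := by
  funext x
  simp [fiberIntegral]

theorem contDiff_fiberIntegral [FiniteDimensional ℝ E]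
    {Φ : ℝ × E → (ℝ × E) [⋀^Fin (k + 1)]→L[ℝ] G} (hΦ : ContDiff ℝ ∞ Φ) (a b : ℝ) :
    ContDiff ℝ ∞ (fiberIntegral a b Φ) :=
  contDiff_integral ((timeContraction E G k).contDiff.comp hΦ) a b

theorem integral_alternatizeUncurryFin [CompleteSpace G] {f : ℝ → E →L[ℝ] E [⋀^Fin k]→L[ℝ] G}
    (hf : Continuous f) (a b : ℝ) :
    ∫ t in a..b, alternatizeUncurryFin (f t) = alternatizeUncurryFin (∫ t in a..b, f t) :=
  ContinuousLinearMap.intervalIntegral_comp_comm (𝕜 := ℝ) (E := E →L[ℝ] E [⋀^Fin k]→L[ℝ] G)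
    (F := E [⋀^Fin (k + 1)]→L[ℝ] G) (alternatizeUncurryFinCLM ℝ E G)
    (Continuous.intervalIntegrable (μ := MeasureTheory.volume)
      (E := E →L[ℝ] E [⋀^Fin k]→L[ℝ] G) hf a b)

theorem extDeriv_fiberIntegral [FiniteDimensional ℝ E] [CompleteSpace G]
    {Φ : ℝ × E → (ℝ × E) [⋀^Fin (k + 1)]→L[ℝ] G} (hΦ : ContDiff ℝ ∞ Φ) (a b : ℝ) (x : E) :
    extDeriv (fiberIntegral a b Φ) x =
      sliceRestriction E G (k + 1) (Φ (b, x)) - sliceRestriction E G (k + 1) (Φ (a, x)) -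
        fiberIntegral a b (extDeriv Φ) x := by
  have hdiff : Differentiable ℝ Φ := hΦ.differentiable (by simp)
  have hcont : Continuous fun t : ℝ => fderiv ℝ Φ (t, x) :=
    (hΦ.continuous_fderiv (by simp)).comp (by fun_prop)
  have hfderiv : fderiv ℝ (fiberIntegral a b Φ) x = ∫ t in a..b,
      ((timeContraction E G k).comp (fderiv ℝ Φ (t, x))).comp (ContinuousLinearMap.inr ℝ ℝ E) := by
    refine (hasFDerivAt_integral_of_contDiff (((timeContraction E G k).contDiff.comp hΦ).of_le
      (by exact_mod_cast le_top)) a b x).fderiv.trans ?_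
    simp only [(timeContraction E G k).hasFDerivAt.comp _ (hdiff _).hasFDerivAt |>.fderiv]
  have hFTC : ∫ t in a..b, sliceRestriction E G (k + 1) (fderiv ℝ Φ (t, x) (1, 0)) =
      sliceRestriction E G (k + 1) (Φ (b, x)) - sliceRestriction E G (k + 1) (Φ (a, x)) := by
    refine intervalIntegral.integral_eq_sub_of_hasDerivAt
      (f := fun t => sliceRestriction E G (k + 1) (Φ (t, x))) (fun t _ => ?_)
      (((sliceRestriction E G (k + 1)).continuous.comp
        (hcont.clm_apply continuous_const)).intervalIntegrable _ _)
    exact (sliceRestriction E G (k + 1)).hasFDerivAt.comp_hasDerivAt t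
      ((hdiff (t, x)).hasFDerivAt.comp_hasDerivAt t
        ((hasDerivAt_id t).prodMk (hasDerivAt_const t x)))
  rw [extDeriv, hfderiv, ← integral_alternatizeUncurryFin
    ((continuous_const.clm_comp hcont).clm_comp continuous_const), ← hFTC, fiberIntegral,
    ← intervalIntegral.integral_sub]
  · simp only [alternatizeUncurryFin_timeContraction]
    rfl
  · exact ((sliceRestriction E G (k + 1)).continuous.comp
      (hcont.clm_apply continuous_const)).intervalIntegrable _ _
  · exact ((timeContraction E G (k + 1)).continuous.comp
      ((contDiff_extDeriv hΦ).continuous.comp (by fun_prop))).intervalIntegrable _ _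

/-- The pullback `f^* α` of a form on a vector space by a map `f`. -/
def pullbackForm (f : E → F) (α : F → F [⋀^Fin k]→L[ℝ] G) (x : E) : E [⋀^Fin k]→L[ℝ] G :=
  (α (f x)).compContinuousLinearMap (fderiv ℝ f x)

theorem contDiff_pullbackForm {f : E → F} {α : F → F [⋀^Fin k]→L[ℝ] G}
    (hf : ContDiff ℝ ∞ f) (hα : ContDiff ℝ ∞ α) : ContDiff ℝ ∞ (pullbackForm f α) :=
  contDiff_iff_contDiffAt.2 fun _ => contDiffAt_compContinuousLinearMap
    (hα.comp hf).contDiffAt (hf.fderiv_right (m := ∞) (by simp)).contDiffAt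

theorem extDeriv_pullbackForm {f : E → F} {α : F → F [⋀^Fin k]→L[ℝ] G}
    (hf : ContDiff ℝ ∞ f) (hα : Differentiable ℝ α) :
    extDeriv (pullbackForm f α) = pullbackForm f (extDeriv α) :=
  funext fun x => extDeriv_pullback (hα (f x)) hf.contDiffAt two_le_infty

theorem pullbackForm_zero (f : E → F) : pullbackForm f (0 : F → F [⋀^Fin k]→L[ℝ] G) = 0 := rfl

theorem pullbackForm_id (α : E → E [⋀^Fin k]→L[ℝ] G) : pullbackForm (fun x => x) α = α := by
  funext x
  rw [pullbackForm, fderiv_fun_id]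
  rfl

theorem pullbackForm_const (y : F) (α : F → F [⋀^Fin (k + 1)]→L[ℝ] G) :
    pullbackForm (fun _ : E => y) α = 0 := by
  funext x
  rw [pullbackForm, fderiv_fun_const]
  ext v
  exact (α y).map_coord_zero 0 rfl

theorem sliceRestriction_pullbackForm {f : ℝ × E → F} (hf : Differentiable ℝ f)
    (α : F → F [⋀^Fin k]→L[ℝ] G) (t : ℝ) (x : E) :
    sliceRestriction E G k (pullbackForm f α (t, x)) = pullbackForm (fun x => f (t, x)) α x := by
  have h : fderiv ℝ (fun x => f (t, x)) x =
      (fderiv ℝ f (t, x)).comp (ContinuousLinearMap.inr ℝ ℝ E) :=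
    ((hf (t, x)).hasFDerivAt.comp x (hasFDerivAt_prodMk_right t x)).fderiv
  rw [pullbackForm, pullbackForm, h]
  rfl

theorem extDeriv_fiberIntegral_pullbackForm [FiniteDimensional ℝ E] [CompleteSpace G]
    {f : ℝ × E → F} {α : F → F [⋀^Fin (k + 1)]→L[ℝ] G} (hf : ContDiff ℝ ∞ f)
    (hα : ContDiff ℝ ∞ α) (a b : ℝ) (x : E) :
    extDeriv (fiberIntegral a b (pullbackForm f α)) x =
      pullbackForm (fun x => f (b, x)) α x - pullbackForm (fun x => f (a, x)) α x -
        fiberIntegral a b (pullbackForm f (extDeriv α)) x := by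
  rw [extDeriv_fiberIntegral (contDiff_pullbackForm hf hα),
    extDeriv_pullbackForm hf (hα.differentiable (by simp)),
    sliceRestriction_pullbackForm (hf.differentiable (by simp)),
    sliceRestriction_pullbackForm (hf.differentiable (by simp))]

theorem extDeriv_fiberIntegral_pullbackForm_of_closed [FiniteDimensional ℝ E] [CompleteSpace G]
    {f : ℝ × E → F} {α : F → F [⋀^Fin (k + 1)]→L[ℝ] G} (hf : ContDiff ℝ ∞ f)
    (hα : ContDiff ℝ ∞ α) (hd : extDeriv α = 0) (a b : ℝ) (x : E) :
    extDeriv (fiberIntegral a b (pullbackForm f α)) x =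
      pullbackForm (fun x => f (b, x)) α x - pullbackForm (fun x => f (a, x)) α x := by
  rw [extDeriv_fiberIntegral_pullbackForm hf hα, hd, pullbackForm_zero, fiberIntegral_zero,
    Pi.zero_apply, sub_zero]

theorem exists_extDeriv_eq [FiniteDimensional ℝ E] [CompleteSpace G]
    {α : E → E [⋀^Fin (k + 1)]→L[ℝ] G} (hα : ContDiff ℝ ∞ α) (hd : extDeriv α = 0) :
    ∃ η : E → E [⋀^Fin k]→L[ℝ] G, ContDiff ℝ ∞ η ∧ extDeriv η = α := by
  have hf : ContDiff ℝ ∞ fun p : ℝ × E => p.1 • p.2 := contDiff_fst.smul contDiff_snd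
  refine ⟨_, contDiff_fiberIntegral (contDiff_pullbackForm hf hα) 0 1, funext fun x => ?_⟩
  rw [extDeriv_fiberIntegral_pullbackForm_of_closed hf hα hd]
  simp only [one_smul, zero_smul, pullbackForm_id, pullbackForm_const, Pi.zero_apply, sub_zero]

end Homotopy

section LinePrimitive

variable {E G : Type*} [NormedAddCommGroup E] [NormedSpace ℝ E] [NormedAddCommGroup G]
  [NormedSpace ℝ G] {k : ℕ} {e : E} {m : E →L[ℝ] ℝ} {a : ℝ}

/-- The homotopy that contracts `E` to the hyperplane `m = a` along the lines in direction `e`,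
provided that `m e = 1`. -/
def lineHomotopy (e : E) (m : E →L[ℝ] ℝ) (a : ℝ) (p : ℝ × E) : E :=
  p.2 + ((p.1 - 1) * (m p.2 - a)) • e

theorem contDiff_lineHomotopy (e : E) (m : E →L[ℝ] ℝ) (a : ℝ) :
    ContDiff ℝ ∞ (lineHomotopy e m a) := by
  unfold lineHomotopy
  fun_prop

theorem lineHomotopy_one (x : E) : lineHomotopy e m a (1, x) = x := by simp [lineHomotopy]

theorem apply_lineHomotopy_zero (hem : m e = 1) (x : E) : m (lineHomotopy e m a (0, x)) = a := by
  simp [lineHomotopy, hem]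

/-- The primitive of a closed form obtained by integration along the lines in direction `e`,
starting from the hyperplane `m = a`. -/
def linePrimitive (e : E) (m : E →L[ℝ] ℝ) (a : ℝ) (α : E → E [⋀^Fin (k + 1)]→L[ℝ] G) :
    E → E [⋀^Fin k]→L[ℝ] G :=
  fiberIntegral 0 1 (pullbackForm (lineHomotopy e m a) α)

theorem contDiff_linePrimitive [FiniteDimensional ℝ E] (e : E) (m : E →L[ℝ] ℝ) (a : ℝ)
    {α : E → E [⋀^Fin (k + 1)]→L[ℝ] G} (hα : ContDiff ℝ ∞ α) :
    ContDiff ℝ ∞ (linePrimitive e m a α) :=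
  contDiff_fiberIntegral (contDiff_pullbackForm (contDiff_lineHomotopy e m a) hα) 0 1

theorem extDeriv_linePrimitive [FiniteDimensional ℝ E] [CompleteSpace G] (hem : m e = 1)
    {α : E → E [⋀^Fin (k + 1)]→L[ℝ] G} (hα : ContDiff ℝ ∞ α) (hd : extDeriv α = 0)
    (ha : ∀ y, m y = a → α y = 0) : extDeriv (linePrimitive e m a α) = α := by
  funext x
  have hstart : pullbackForm (fun x => lineHomotopy e m a (0, x)) α x = 0 := by
    rw [pullbackForm, ha _ (apply_lineHomotopy_zero hem x)]
    rfl
  rw [linePrimitive, extDeriv_fiberIntegral_pullbackForm_of_closed (contDiff_lineHomotopy e m a)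
    hα hd, hstart, sub_zero]
  simp only [lineHomotopy_one, pullbackForm_id]

theorem linePrimitive_eq_zero {α : E → E [⋀^Fin (k + 1)]→L[ℝ] G} {x : E}
    (h : ∀ t ∈ Set.Icc (0 : ℝ) 1, α (lineHomotopy e m a (t, x)) = 0) :
    linePrimitive e m a α x = 0 := by
  rw [linePrimitive, fiberIntegral,
    intervalIntegral.integral_congr (g := fun _ => (0 : E [⋀^Fin k]→L[ℝ] G))]
  · exact intervalIntegral.integral_zero
  · intro t ht
    rw [Set.uIcc_of_le zero_le_one] at ht
    simp only [pullbackForm, h t ht]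
    rfl

end LinePrimitive

section CompactSupport

variable {ι : Type*} {G : Type*} [NormedAddCommGroup G] [NormedSpace ℝ G] {k : ℕ}
  {T : Finset ι} {i : ι} {R : ℝ}

/-- The function (or form) `α` vanishes outside the slab `{x | ∀ i ∈ T, |x i| ≤ R}`, which is
bounded in the directions of the coordinates in `T` only. -/
def SupportedInSlab {N : Type*} [Zero N] (T : Finset ι) (R : ℝ) (α : EuclideanSpace ℝ ι → N) :
    Prop :=
  ∀ i ∈ T, ∀ x, R < |x i| → α x = 0

theorem SupportedInSlab.sub {N : Type*} [AddGroup N] {α β : EuclideanSpace ℝ ι → N}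
    (hα : SupportedInSlab T R α) (hβ : SupportedInSlab T R β) : SupportedInSlab T R (α - β) :=
  fun i hi x hx => by rw [Pi.sub_apply, hα i hi x hx, hβ i hi x hx, sub_zero]

theorem supportedInSlab_insert [DecidableEq ι] {N : Type*} [Zero N]
    {α : EuclideanSpace ℝ ι → N} : SupportedInSlab (insert i T) R α ↔
      (∀ x, R < |x i| → α x = 0) ∧ SupportedInSlab T R α :=
  Finset.forall_mem_insert ..

variable [Fintype ι]

theorem SupportedInSlab.of_hasCompactSupport {N : Type*} [Zero N] {α : EuclideanSpace ℝ ι → N}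
    (hα : HasCompactSupport α) : ∃ R > 0, SupportedInSlab Finset.univ R α := by
  obtain ⟨R, hR, hbound⟩ := hα.isCompact.isBounded.exists_pos_norm_le
  refine ⟨R, hR, fun i _ x hx => ?_⟩
  contrapose! hx
  exact (PiLp.norm_apply_le x i).trans (hbound x (subset_tsupport _ hx))

theorem SupportedInSlab.hasCompactSupport {N : Type*} [Zero N] {α : EuclideanSpace ℝ ι → N}
    (hα : SupportedInSlab Finset.univ R α) : HasCompactSupport α := by
  refine HasCompactSupport.intro ((EuclideanSpace.equiv ι ℝ).toHomeomorph.isCompact_preimage.2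
    (isCompact_univ_pi fun _ => isCompact_Icc (a := -R) (b := R))) fun x hx => ?_
  obtain ⟨i, hi⟩ : ∃ i, x i ∉ Set.Icc (-R) R := by
    by_contra! h
    exact hx fun i _ => h i
  exact hα i (Finset.mem_univ i) x (not_le.1 fun h => hi (abs_le.1 h))

theorem SupportedInSlab.eq_of_extDeriv_eq (hT : T.Nonempty)
    {μ ν : EuclideanSpace ℝ ι → EuclideanSpace ℝ ι [⋀^Fin 0]→L[ℝ] G}
    (hμ : Differentiable ℝ μ) (hν : Differentiable ℝ ν) (hd : extDeriv μ = extDeriv ν)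
    (hsμ : SupportedInSlab T R μ) (hsν : SupportedInSlab T R ν) : μ = ν := by
  classical
  obtain ⟨j, hj⟩ := hT
  have hfar : R < |(EuclideanSpace.single j (|R| + 1) : EuclideanSpace ℝ ι) j| := by
    rw [PiLp.single_apply, if_pos rfl, abs_of_pos (by positivity)]
    linarith [le_abs_self R]
  have hclosed : extDeriv (μ - ν) = 0 := funext fun x => by
    rw [extDeriv_sub (hμ x) (hν x), hd, sub_self, Pi.zero_apply]
  funext x
  rw [← sub_eq_zero, ← Pi.sub_apply, eq_of_extDeriv_eq_zero (hμ.sub hν) hclosed x,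
    hsμ.sub hsν j hj _ hfar]

section OneSidedPrimitives

variable [DecidableEq ι]

theorem lineHomotopy_single_apply_self (a t : ℝ) (x : EuclideanSpace ℝ ι) :
    lineHomotopy (EuclideanSpace.single i 1) (EuclideanSpace.proj i) a (t, x) i =
      t * x i + (1 - t) * a := by
  have h : lineHomotopy (EuclideanSpace.single i 1) (EuclideanSpace.proj i) a (t, x) i =
      x i + (t - 1) * (x i - a) := by simp [lineHomotopy]
  rw [h]
  ring

theorem lineHomotopy_single_apply_of_ne {j : ι} (hj : j ≠ i) (a t : ℝ) (x : EuclideanSpace ℝ ι) :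
    lineHomotopy (EuclideanSpace.single i 1) (EuclideanSpace.proj i) a (t, x) j = x j := by
  simp [lineHomotopy, hj]

/- Integrate along the `i`-th axis, coming from the side `c * x i > R` where `α` vanishes. -/
theorem exists_extDeriv_eq_of_supportedInSlab_insert [CompleteSpace G] {c : ℝ} (hR : 0 < R)
    (hc : |c| = 1) (hi : i ∉ T)
    {α : EuclideanSpace ℝ ι → EuclideanSpace ℝ ι [⋀^Fin (k + 1)]→L[ℝ] G}
    (hα : ContDiff ℝ ∞ α) (hd : extDeriv α = 0) (hs : SupportedInSlab (insert i T) R α) :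
    ∃ μ : EuclideanSpace ℝ ι → EuclideanSpace ℝ ι [⋀^Fin k]→L[ℝ] G,
      ContDiff ℝ ∞ μ ∧ extDeriv μ = α ∧ (∀ x, R < c * x i → μ x = 0) ∧ SupportedInSlab T R μ := by
  obtain ⟨hsi, hsT⟩ := supportedInSlab_insert.1 hs
  have hcc : c * c = 1 := by rw [← abs_mul_abs_self, hc, one_mul]
  refine ⟨linePrimitive (EuclideanSpace.single i 1) (EuclideanSpace.proj i) (c * (R + 1)) α,
    contDiff_linePrimitive _ _ _ hα, ?_, fun x hx => ?_, fun j hj x hx => ?_⟩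
  · refine extDeriv_linePrimitive (by simp) hα hd fun y hy => hsi y ?_
    rw [show y i = c * (R + 1) from hy, abs_mul, hc, one_mul, abs_of_pos (by linarith)]
    linarith
  · refine linePrimitive_eq_zero fun t ⟨ht₀, ht₁⟩ => hsi _ ?_
    rw [lineHomotopy_single_apply_self]
    calc R < t * (c * x i) + (1 - t) * (R + 1) := by
          rcases ht₀.eq_or_lt with rfl | ht₀
          · linarith
          · nlinarith
      _ = c * (t * x i + (1 - t) * (c * (R + 1))) := by linear_combination (t - 1) * (R + 1) * hcc
      _ ≤ |c * (t * x i + (1 - t) * (c * (R + 1)))| := le_abs_self _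
      _ = |t * x i + (1 - t) * (c * (R + 1))| := by rw [abs_mul, hc, one_mul]
  · refine linePrimitive_eq_zero fun t _ => hsT j hj _ ?_
    rwa [lineHomotopy_single_apply_of_ne (ne_of_mem_of_not_mem hj hi)]

/- The primitive is `μ - d(χ γ)`, where the cutoff `χ` depends on the `i`-th coordinate only, and is
`0` where it is negative and `1` where it is at least `R`. -/
theorem exists_extDeriv_eq_of_one_sided_primitives (hR : 0 < R)
    {μ ν : EuclideanSpace ℝ ι → EuclideanSpace ℝ ι [⋀^Fin (k + 1)]→L[ℝ] G}
    {γ : EuclideanSpace ℝ ι → EuclideanSpace ℝ ι [⋀^Fin k]→L[ℝ] G}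
    (hμ : ContDiff ℝ ∞ μ) (hγ : ContDiff ℝ ∞ γ) (hdγ : extDeriv γ = μ - ν)
    (hμi : ∀ x, x i < -R → μ x = 0) (hνi : ∀ x, R < x i → ν x = 0)
    (hsμ : SupportedInSlab T R μ) (hsγ : SupportedInSlab T R γ) :
    ∃ η : EuclideanSpace ℝ ι → EuclideanSpace ℝ ι [⋀^Fin (k + 1)]→L[ℝ] G,
      ContDiff ℝ ∞ η ∧ extDeriv η = extDeriv μ ∧ SupportedInSlab (insert i T) R η := by
  let χ : EuclideanSpace ℝ ι → ℝ := fun x => Real.smoothTransition (x i / R)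
  have hχγ : ContDiff ℝ ∞ fun x => χ x • γ x :=
    (Real.smoothTransition.contDiff.comp (by fun_prop)).smul hγ
  have hcont (j : ι) : Continuous fun y : EuclideanSpace ℝ ι => y j := by fun_prop
  refine ⟨μ - extDeriv fun x => χ x • γ x, hμ.sub (contDiff_extDeriv hχγ), funext fun x => ?_,
    supportedInSlab_insert.2 ⟨fun x hx => ?_, hsμ.sub fun j hj x hx => ?_⟩⟩
  · rw [extDeriv_sub (hμ.differentiable (by simp) x)
      ((contDiff_extDeriv hχγ).differentiable (by simp) x),
      extDeriv_extDeriv hχγ two_le_infty, Pi.zero_apply, sub_zero]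
  · rw [Pi.sub_apply]
    rcases lt_abs.1 hx with hx | hx
    · have hχ : (fun x => χ x • γ x) =ᶠ[𝓝 x] γ := by
        filter_upwards [(hcont i).continuousAt.eventually (lt_mem_nhds hx)] with y hy
        simp only [χ]
        rw [Real.smoothTransition.one_of_one_le ((one_le_div hR).2 hy.le), one_smul]
      rw [hχ.extDeriv_eq, hdγ, Pi.sub_apply, hνi x hx, sub_zero, sub_self]
    · rw [hμi x (lt_neg_of_lt_neg hx), extDeriv_eq_zero_of_eventually, sub_zero]
      filter_upwards [(hcont i).continuousAt.eventually
        (gt_mem_nhds (show x i < 0 by linarith))] with y hy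
      simp only [χ]
      rw [Real.smoothTransition.zero_of_nonpos (div_nonpos_of_nonpos_of_nonneg hy.le hR.le),
        zero_smul]
  · refine extDeriv_eq_zero_of_eventually ?_
    filter_upwards [(hcont j).abs.continuousAt.eventually (lt_mem_nhds hx)] with y hy
    rw [hsγ j hj y hy, smul_zero]

theorem exists_one_sided_primitives [CompleteSpace G] (hR : 0 < R) (hi : i ∉ T)
    {α : EuclideanSpace ℝ ι → EuclideanSpace ℝ ι [⋀^Fin (k + 1)]→L[ℝ] G}
    (hα : ContDiff ℝ ∞ α) (hd : extDeriv α = 0) (hs : SupportedInSlab (insert i T) R α) :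
    (∃ μ : EuclideanSpace ℝ ι → EuclideanSpace ℝ ι [⋀^Fin k]→L[ℝ] G, ContDiff ℝ ∞ μ ∧
      extDeriv μ = α ∧ (∀ x, x i < -R → μ x = 0) ∧ SupportedInSlab T R μ) ∧
    ∃ ν : EuclideanSpace ℝ ι → EuclideanSpace ℝ ι [⋀^Fin k]→L[ℝ] G, ContDiff ℝ ∞ ν ∧
      extDeriv ν = α ∧ (∀ x, R < x i → ν x = 0) ∧ SupportedInSlab T R ν := by
  obtain ⟨μ, hμ, hdμ, hμi, hsμ⟩ := exists_extDeriv_eq_of_supportedInSlab_insert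
    (c := -1) hR (by simp) hi hα hd hs
  obtain ⟨ν, hν, hdν, hνi, hsν⟩ := exists_extDeriv_eq_of_supportedInSlab_insert
    (c := 1) hR (by simp) hi hα hd hs
  exact ⟨⟨μ, hμ, hdμ, fun x hx => hμi x (by linarith), hsμ⟩,
    ⟨ν, hν, hdν, fun x hx => hνi x (by linarith), hsν⟩⟩

end OneSidedPrimitives

theorem exists_insert_eq_of_succ_lt_card {α : Type*} [DecidableEq α] {s : Finset α} {m : ℕ}
    (h : m + 1 < s.card) : ∃ a t, a ∉ t ∧ insert a t = s ∧ m < t.card := by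
  obtain ⟨a, ha⟩ := Finset.card_pos.1 (Nat.zero_lt_of_lt h)
  exact ⟨a, s.erase a, Finset.notMem_erase a s, Finset.insert_erase ha, by
    rw [Finset.card_erase_of_mem ha]; omega⟩

theorem exists_extDeriv_eq_of_supportedInSlab [CompleteSpace G] (hR : 0 < R) (hk : k + 1 < T.card)
    {α : EuclideanSpace ℝ ι → EuclideanSpace ℝ ι [⋀^Fin (k + 1)]→L[ℝ] G}
    (hα : ContDiff ℝ ∞ α) (hd : extDeriv α = 0) (hs : SupportedInSlab T R α) :
    ∃ μ : EuclideanSpace ℝ ι → EuclideanSpace ℝ ι [⋀^Fin k]→L[ℝ] G,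
      ContDiff ℝ ∞ μ ∧ extDeriv μ = α ∧ SupportedInSlab T R μ := by
  classical
  induction k generalizing T with
  | zero =>
    obtain ⟨i, T, hi, rfl, hT⟩ := exists_insert_eq_of_succ_lt_card hk
    obtain ⟨⟨μ, hμ, hdμ, hμi, hsμ⟩, ⟨ν, hν, hdν, hνi, hsν⟩⟩ :=
      exists_one_sided_primitives hR hi hα hd hs
    have hμν : μ = ν := SupportedInSlab.eq_of_extDeriv_eq (Finset.card_pos.1 hT)
      (hμ.differentiable (by simp)) (hν.differentiable (by simp)) (hdμ.trans hdν.symm) hsμ hsν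
    refine ⟨μ, hμ, hdμ, supportedInSlab_insert.2 ⟨fun x hx => ?_, hsμ⟩⟩
    rcases lt_abs.1 hx with hx | hx
    · rw [hμν, hνi x hx]
    · exact hμi x (lt_neg_of_lt_neg hx)
  | succ k ih =>
    obtain ⟨i, T, hi, rfl, hT⟩ := exists_insert_eq_of_succ_lt_card hk
    obtain ⟨⟨μ, hμ, hdμ, hμi, hsμ⟩, ⟨ν, hν, hdν, hνi, hsν⟩⟩ :=
      exists_one_sided_primitives hR hi hα hd hs
    have hclosed : extDeriv (μ - ν) = 0 := funext fun x => by
      rw [extDeriv_sub (hμ.differentiable (by simp) x) (hν.differentiable (by simp) x), hdμ, hdν,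
        sub_self, Pi.zero_apply]
    obtain ⟨γ, hγ, hdγ, hsγ⟩ := ih hT (hμ.sub hν) hclosed (hsμ.sub hsν)
    obtain ⟨η, hη, hdη, hsη⟩ :=
      exists_extDeriv_eq_of_one_sided_primitives hR hμ hγ hdγ hμi hνi hsμ hsγ
    exact ⟨η, hη, hdη.trans hdμ, hsη⟩

theorem exists_extDeriv_eq_of_hasCompactSupport [CompleteSpace G] (hk : k + 1 < Fintype.card ι)
    {α : EuclideanSpace ℝ ι → EuclideanSpace ℝ ι [⋀^Fin (k + 1)]→L[ℝ] G}
    (hα : ContDiff ℝ ∞ α) (hd : extDeriv α = 0) (hs : HasCompactSupport α) :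
    ∃ μ : EuclideanSpace ℝ ι → EuclideanSpace ℝ ι [⋀^Fin k]→L[ℝ] G,
      ContDiff ℝ ∞ μ ∧ extDeriv μ = α ∧ HasCompactSupport μ := by
  obtain ⟨R, hR, hsR⟩ := SupportedInSlab.of_hasCompactSupport hs
  obtain ⟨μ, hμ, hdμ, hsμ⟩ := exists_extDeriv_eq_of_supportedInSlab hR hk hα hd hsR
  exact ⟨μ, hμ, hdμ, hsμ.hasCompactSupport⟩

end CompactSupport

/-- The model space `ℝⁿ` of `n`-manifolds. In Mathlib it is also, by definition, each tangent space
of an `n`-manifold. -/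
abbrev Model (n : ℕ) : Type := EuclideanSpace ℝ (Fin n)

section LocalExpression

variable {n : ℕ} {M : Type*} [TopologicalSpace M] [ChartedSpace (EuclideanSpace ℝ (Fin n)) M]
  {k : ℕ} {φ ψ : OpenPartialHomeomorph M (Model n)} {x : M} {y : Model n}

/-- The value of a form at a point, as a form on the model space: the type of `α.val x` does not
depend on `x`. -/
def Form.val (α : Form n M k) (x : M) : Model n [⋀^Fin k]→L[ℝ] ℝ := α x

/-- The expression of a form in an arbitrary chart `φ`, that is, the pullback of the form by
`φ⁻¹`. -/
def Form.writtenIn (α : Form n M k) (φ : OpenPartialHomeomorph M (Model n)) (y : Model n) :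
    Model n [⋀^Fin k]→L[ℝ] ℝ :=
  (α.val (φ.symm y)).compContinuousLinearMap (mfderiv 𝓘(ℝ, Model n) (𝓡 n) φ.symm y)

/-- Smoothness of a form at a point, read in the preferred chart around that point. -/
def Form.SmoothAt (α : Form n M k) (x : M) : Prop :=
  ContDiffAt ℝ ∞ (α.writtenIn (chartAt (Model n) x)) (chartAt (Model n) x x)

theorem Form.inChart_eq_writtenIn (α : Form n M k) (x₀ : M) :
    α.inChart x₀ = α.writtenIn (chartAt (Model n) x₀) := rfl

theorem Form.val_d (α : Form n M k) (x : M) :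
    α.d.val x = (extDeriv (α.writtenIn (chartAt (Model n) x))
      (chartAt (Model n) x x)).compContinuousLinearMap
        (mfderiv (𝓡 n) 𝓘(ℝ, Model n) (chartAt (Model n) x) x) := rfl

theorem Form.writtenIn_eventuallyEq {α β : Form n M k} (hx : x ∈ φ.source)
    (h : ∀ᶠ y in 𝓝 x, α y = β y) : α.writtenIn φ =ᶠ[𝓝 (φ x)] β.writtenIn φ := by
  filter_upwards [(φ.tendsto_symm hx).eventually h] with y hy
  have hval : α.val (φ.symm y) = β.val (φ.symm y) := hy
  rw [Form.writtenIn, hval, Form.writtenIn]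

theorem Form.SmoothAt.congr {α β : Form n M k} (hα : α.SmoothAt x)
    (h : ∀ᶠ y in 𝓝 x, α y = β y) : β.SmoothAt x :=
  ContDiffAt.congr_of_eventuallyEq hα (Form.writtenIn_eventuallyEq (mem_chart_source _ x) h).symm

theorem Form.d_congr {α β : Form n M k} (h : ∀ᶠ y in 𝓝 x, α y = β y) : α.d x = β.d x := by
  have hval : α.d.val x = β.d.val x := by
    rw [Form.val_d, (Form.writtenIn_eventuallyEq (mem_chart_source _ x) h).extDeriv_eq, Form.val_d]
  exact hval

theorem mdifferentiable_of_mem_maximalAtlas (hφ : φ ∈ IsManifold.maximalAtlas (𝓡 n) ∞ M) :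
    φ.MDifferentiable (𝓡 n) 𝓘(ℝ, Model n) :=
  ⟨(contMDiffOn_of_mem_maximalAtlas hφ).mdifferentiableOn (by simp),
    (contMDiffOn_symm_of_mem_maximalAtlas hφ).mdifferentiableOn (by simp)⟩

theorem contDiffAt_transition (hφ : φ ∈ IsManifold.maximalAtlas (𝓡 n) ∞ M)
    (hψ : ψ ∈ IsManifold.maximalAtlas (𝓡 n) ∞ M) (hy : y ∈ ψ.target)
    (hy' : ψ.symm y ∈ φ.source) : ContDiffAt ℝ ∞ (φ ∘ ψ.symm) y :=
  ((contMDiffAt_of_mem_maximalAtlas hφ hy').comp y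
    (contMDiffAt_symm_of_mem_maximalAtlas hψ hy)).contDiffAt

theorem fderiv_transition (hφ : φ ∈ IsManifold.maximalAtlas (𝓡 n) ∞ M)
    (hψ : ψ ∈ IsManifold.maximalAtlas (𝓡 n) ∞ M) (hy : y ∈ ψ.target)
    (hy' : ψ.symm y ∈ φ.source) :
    fderiv ℝ (φ ∘ ψ.symm) y = (mfderiv (𝓡 n) 𝓘(ℝ, Model n) φ (ψ.symm y)).comp
      (mfderiv 𝓘(ℝ, Model n) (𝓡 n) ψ.symm y) := by
  rw [← mfderiv_eq_fderiv]
  exact mfderiv_comp y ((mdifferentiable_of_mem_maximalAtlas hφ).mdifferentiableAt hy')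
    ((mdifferentiable_of_mem_maximalAtlas hψ).mdifferentiableAt_symm hy)

theorem Form.val_eq_compContinuousLinearMap_writtenIn (α : Form n M k)
    (hφ : φ ∈ IsManifold.maximalAtlas (𝓡 n) ∞ M) (hx : x ∈ φ.source) :
    α.val x = (α.writtenIn φ (φ x)).compContinuousLinearMap
      (mfderiv (𝓡 n) 𝓘(ℝ, Model n) φ x) := by
  have hderiv := (mdifferentiable_of_mem_maximalAtlas hφ).symm_comp_deriv hx
  ext v
  rw [Form.writtenIn, φ.left_inv hx]
  exact congrArg (α.val x) (funext fun i => (DFunLike.congr_fun hderiv (v i)).symm)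

theorem Form.eq_of_writtenIn_eq {α β : Form n M k} (hφ : φ ∈ IsManifold.maximalAtlas (𝓡 n) ∞ M)
    (hx : x ∈ φ.source) (h : α.writtenIn φ (φ x) = β.writtenIn φ (φ x)) : α x = β x := by
  have hval : α.val x = β.val x := by
    rw [α.val_eq_compContinuousLinearMap_writtenIn hφ hx, h,
      ← β.val_eq_compContinuousLinearMap_writtenIn hφ hx]
  exact hval

theorem Form.writtenIn_eq_pullbackForm (α : Form n M k)
    (hφ : φ ∈ IsManifold.maximalAtlas (𝓡 n) ∞ M) (hψ : ψ ∈ IsManifold.maximalAtlas (𝓡 n) ∞ M)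
    (hy : y ∈ ψ.target) (hy' : ψ.symm y ∈ φ.source) :
    α.writtenIn ψ y = pullbackForm (φ ∘ ψ.symm) (α.writtenIn φ) y := by
  rw [pullbackForm, fderiv_transition hφ hψ hy hy', Form.writtenIn,
    α.val_eq_compContinuousLinearMap_writtenIn hφ hy']
  rfl

theorem Form.writtenIn_eventuallyEq_pullbackForm (α : Form n M k)
    (hφ : φ ∈ IsManifold.maximalAtlas (𝓡 n) ∞ M) (hψ : ψ ∈ IsManifold.maximalAtlas (𝓡 n) ∞ M)
    (hy : y ∈ ψ.target) (hy' : ψ.symm y ∈ φ.source) :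
    α.writtenIn ψ =ᶠ[𝓝 y] pullbackForm (φ ∘ ψ.symm) (α.writtenIn φ) := by
  filter_upwards [ψ.open_target.mem_nhds hy,
    (ψ.continuousAt_symm hy).preimage_mem_nhds (φ.open_source.mem_nhds hy')] with z hz hz'
  exact α.writtenIn_eq_pullbackForm hφ hψ hz hz'

theorem Form.contDiffAt_writtenIn_of_mem_maximalAtlas {α : Form n M k}
    (hφ : φ ∈ IsManifold.maximalAtlas (𝓡 n) ∞ M) (hψ : ψ ∈ IsManifold.maximalAtlas (𝓡 n) ∞ M)
    (hx : x ∈ φ.source) (hx' : x ∈ ψ.source) (h : ContDiffAt ℝ ∞ (α.writtenIn φ) (φ x)) :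
    ContDiffAt ℝ ∞ (α.writtenIn ψ) (ψ x) := by
  rw [← ψ.left_inv hx'] at hx h
  have htransition := contDiffAt_transition hφ hψ (ψ.map_source hx') hx
  have hpullback : ContDiffAt ℝ ∞ (pullbackForm (φ ∘ ψ.symm) (α.writtenIn φ)) (ψ x) :=
    contDiffAt_compContinuousLinearMap
      (ContDiffAt.comp (f := φ ∘ ψ.symm) (ψ x) h htransition)
      (htransition.fderiv_right (by simp))
  exact hpullback.congr_of_eventuallyEq
    (α.writtenIn_eventuallyEq_pullbackForm hφ hψ (ψ.map_source hx') hx)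

variable [IsManifold (𝓡 n) ∞ M]

theorem chartAt_mem_maximalAtlas (x : M) :
    chartAt (Model n) x ∈ IsManifold.maximalAtlas (𝓡 n) ∞ M :=
  IsManifold.chart_mem_maximalAtlas x

theorem Form.smoothAt_iff {α : Form n M k} (hφ : φ ∈ IsManifold.maximalAtlas (𝓡 n) ∞ M)
    (hx : x ∈ φ.source) : α.SmoothAt x ↔ ContDiffAt ℝ ∞ (α.writtenIn φ) (φ x) :=
  ⟨Form.contDiffAt_writtenIn_of_mem_maximalAtlas (chartAt_mem_maximalAtlas x) hφ
      (mem_chart_source _ x) hx,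
    Form.contDiffAt_writtenIn_of_mem_maximalAtlas hφ (chartAt_mem_maximalAtlas x) hx
      (mem_chart_source _ x)⟩

theorem Form.smoothOn_iff {α : Form n M k} {s : Set M} (hs : IsOpen s) :
    α.SmoothOn s ↔ ∀ x ∈ s, α.SmoothAt x := by
  constructor
  · intro h x hx
    have hφx := mem_chart_source (Model n) x
    have hx₀ := h x
    simp only [Form.inChart_eq_writtenIn, mfld_simps] at hx₀
    exact hx₀.contDiffAt (Filter.inter_mem
      ((chartAt (Model n) x).open_target.mem_nhds ((chartAt (Model n) x).map_source hφx))
      ((chartAt (Model n) x).tendsto_symm hφx (hs.mem_nhds hx)))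
  · intro h x₀ y hy
    simp only [mfld_simps] at hy
    have hsmooth := (Form.smoothAt_iff (chartAt_mem_maximalAtlas x₀)
      ((chartAt (Model n) x₀).map_target hy.1)).1 (h _ hy.2)
    rw [(chartAt (Model n) x₀).right_inv hy.1] at hsmooth
    exact hsmooth.contDiffWithinAt

theorem Form.writtenIn_d {α : Form n M k} (hφ : φ ∈ IsManifold.maximalAtlas (𝓡 n) ∞ M)
    (hy : y ∈ φ.target) (h : α.SmoothAt (φ.symm y)) :
    α.d.writtenIn φ y = extDeriv (α.writtenIn φ) y := by
  have hc := chartAt_mem_maximalAtlas (n := n) (φ.symm y)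
  have hs := mem_chart_source (Model n) (φ.symm y)
  have hd : DifferentiableAt ℝ (α.writtenIn (chartAt (Model n) (φ.symm y)))
      ((chartAt (Model n) (φ.symm y) ∘ φ.symm) y) := ContDiffAt.differentiableAt h (by simp)
  rw [(α.writtenIn_eventuallyEq_pullbackForm hc hφ hy hs).extDeriv_eq]
  refine Eq.trans ?_ (extDeriv_pullback hd (contDiffAt_transition hc hφ hy hs) two_le_infty).symm
  rw [fderiv_transition hc hφ hy hs, Form.writtenIn, Form.val_d]
  rfl

theorem Form.writtenIn_d_eventuallyEq {α : Form n M k} (hα : ∀ᶠ y in 𝓝 x, α.SmoothAt y) :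
    α.d.writtenIn (chartAt (Model n) x) =ᶠ[𝓝 (chartAt (Model n) x x)]
      extDeriv (α.writtenIn (chartAt (Model n) x)) := by
  have hx := mem_chart_source (Model n) x
  filter_upwards [((chartAt (Model n) x).tendsto_symm hx).eventually hα,
    (chartAt (Model n) x).open_target.mem_nhds ((chartAt (Model n) x).map_source hx)] with y hy hy'
  exact Form.writtenIn_d (chartAt_mem_maximalAtlas x) hy' hy

theorem Form.SmoothAt.d {α : Form n M k} (hα : ∀ᶠ y in 𝓝 x, α.SmoothAt y) : α.d.SmoothAt x :=
  (contDiffAt_extDeriv hα.self_of_nhds).congr_of_eventuallyEq (Form.writtenIn_d_eventuallyEq hα)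

theorem Form.d_d {α : Form n M k} (hα : ∀ᶠ y in 𝓝 x, α.SmoothAt y) : α.d.d x = 0 := by
  have hval : α.d.d.val x = 0 := by
    rw [Form.val_d, (Form.writtenIn_d_eventuallyEq hα).extDeriv_eq,
      extDeriv_extDeriv_apply hα.self_of_nhds two_le_infty]
    rfl
  exact hval

theorem Form.SmoothOn.eventually_smoothAt {α : Form n M k} {s : Set M} (hα : α.SmoothOn s)
    (hs : IsOpen s) (hx : x ∈ s) : ∀ᶠ y in 𝓝 x, α.SmoothAt y :=
  Filter.mem_of_superset (hs.mem_nhds hx) ((Form.smoothOn_iff hs).1 hα)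

theorem Form.SmoothOn.d {α : Form n M k} {s : Set M} (hα : α.SmoothOn s) (hs : IsOpen s) :
    α.d.SmoothOn s :=
  (Form.smoothOn_iff hs).2 fun _ hx => Form.SmoothAt.d (hα.eventually_smoothAt hs hx)

end LocalExpression

section Pullback

variable {n : ℕ} {M : Type*} [TopologicalSpace M] [ChartedSpace (EuclideanSpace ℝ (Fin n)) M]
  {k : ℕ} {φ : OpenPartialHomeomorph M (Model n)} {w : Model n → Model n [⋀^Fin k]→L[ℝ] ℝ}
  {x : M} {y : Model n}

theorem Form.smoothAt_zero (x : M) : (0 : Form n M k).SmoothAt x :=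
  contDiffAt_const (c := 0)

open Classical in
/-- The pullback by the chart `φ` of a form on the model space, extended by zero outside the domain
of `φ`. -/
def Form.ofModel (φ : OpenPartialHomeomorph M (Model n))
    (w : Model n → Model n [⋀^Fin k]→L[ℝ] ℝ) : Form n M k := fun x =>
  if x ∈ φ.source then
    (w (φ x)).compContinuousLinearMap (mfderiv (𝓡 n) 𝓘(ℝ, Model n) φ x)
  else 0

theorem Form.ofModel_eq_zero (hx : x ∈ φ.source → w (φ x) = 0) : Form.ofModel φ w x = 0 := by
  by_cases h : x ∈ φ.source
  · rw [Form.ofModel, if_pos h, hx h]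
    rfl
  · exact if_neg h

theorem Form.ofModel_eventually_eq_zero [T2Space M] (hw : HasCompactSupport w)
    (ht : tsupport w ⊆ φ.target) (hx : x ∉ φ.source) :
    ∀ᶠ y in 𝓝 x, Form.ofModel φ w y = 0 := by
  have hclosed : IsClosed (φ.symm '' tsupport w) :=
    (hw.isCompact.image_of_continuousOn (φ.continuousOn_symm.mono ht)).isClosed
  have hx' : x ∉ φ.symm '' tsupport w := by
    rintro ⟨y, hy, rfl⟩
    exact hx (φ.map_target (ht hy))
  filter_upwards [hclosed.isOpen_compl.mem_nhds hx'] with y hy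
  exact Form.ofModel_eq_zero fun hyφ =>
    image_eq_zero_of_notMem_tsupport fun hyw => hy ⟨φ y, hyw, φ.left_inv hyφ⟩

theorem Form.writtenIn_ofModel (hφ : φ ∈ IsManifold.maximalAtlas (𝓡 n) ∞ M)
    (w : Model n → Model n [⋀^Fin k]→L[ℝ] ℝ) (hy : y ∈ φ.target) :
    (Form.ofModel φ w).writtenIn φ y = w y := by
  have hderiv := (mdifferentiable_of_mem_maximalAtlas hφ).comp_symm_deriv hy
  ext v
  rw [Form.writtenIn, Form.val, Form.ofModel, if_pos (φ.map_target hy), φ.right_inv hy]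
  exact congrArg (w y) (funext fun i => DFunLike.congr_fun hderiv (v i))

theorem Form.writtenIn_ofModel_eventuallyEq (hφ : φ ∈ IsManifold.maximalAtlas (𝓡 n) ∞ M)
    (w : Model n → Model n [⋀^Fin k]→L[ℝ] ℝ) (hy : y ∈ φ.target) :
    (Form.ofModel φ w).writtenIn φ =ᶠ[𝓝 y] w :=
  Filter.mem_of_superset (φ.open_target.mem_nhds hy) fun _ => Form.writtenIn_ofModel hφ w

variable [IsManifold (𝓡 n) ∞ M]

theorem Form.smoothAt_ofModel (hφ : φ ∈ IsManifold.maximalAtlas (𝓡 n) ∞ M)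
    (hw : ContDiff ℝ ∞ w) (hx : x ∈ φ.source) : (Form.ofModel φ w).SmoothAt x :=
  (Form.smoothAt_iff hφ hx).2 (hw.contDiffAt.congr_of_eventuallyEq
    (Form.writtenIn_ofModel_eventuallyEq hφ w (φ.map_source hx)))

theorem Form.d_ofModel (hφ : φ ∈ IsManifold.maximalAtlas (𝓡 n) ∞ M) (hw : ContDiff ℝ ∞ w)
    {α : Form n M (k + 1)} (h : extDeriv w = α.writtenIn φ) (hx : x ∈ φ.source) :
    (Form.ofModel φ w).d x = α x := by
  have hy := φ.map_source hx
  refine Form.eq_of_writtenIn_eq hφ hx ?_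
  rw [Form.writtenIn_d hφ hy (Form.smoothAt_ofModel hφ hw (φ.map_target hy)), ← h]
  exact (Form.writtenIn_ofModel_eventuallyEq hφ w hy).extDeriv_eq

end Pullback

section ChartOntoModel

variable {n : ℕ} {M : Type*} [TopologicalSpace M] [ChartedSpace (EuclideanSpace ℝ (Fin n)) M]
  {k : ℕ} {φ : OpenPartialHomeomorph M (Model n)}

theorem Form.hasCompactSupport_writtenIn (ht : φ.target = Set.univ) {α : Form n M k} {C : Set M}
    (hC : IsCompact C) (hCφ : C ⊆ φ.source) (hα : ∀ x ∉ C, α x = 0) :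
    HasCompactSupport (α.writtenIn φ) := by
  refine HasCompactSupport.intro (hC.image_of_continuousOn (φ.continuousOn.mono hCφ)) fun y hy => ?_
  have hval : α.val (φ.symm y) = 0 :=
    hα _ fun h => hy ⟨_, h, φ.right_inv (ht ▸ Set.mem_univ y)⟩
  rw [Form.writtenIn, hval]
  rfl

variable [IsManifold (𝓡 n) ∞ M]

theorem Form.contDiff_writtenIn (hφ : φ ∈ IsManifold.maximalAtlas (𝓡 n) ∞ M)
    (ht : φ.target = Set.univ) {α : Form n M k} (hα : α.SmoothOn φ.source) :
    ContDiff ℝ ∞ (α.writtenIn φ) := by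
  refine contDiff_iff_contDiffAt.2 fun y => ?_
  have hy : y ∈ φ.target := ht ▸ Set.mem_univ y
  have hsmooth := (Form.smoothOn_iff φ.open_source).1 hα _ (φ.map_target hy)
  rwa [Form.smoothAt_iff hφ (φ.map_target hy), φ.right_inv hy] at hsmooth

theorem Form.extDeriv_writtenIn_eq_zero (hφ : φ ∈ IsManifold.maximalAtlas (𝓡 n) ∞ M)
    (ht : φ.target = Set.univ) {α : Form n M k} (hα : α.SmoothOn φ.source)
    (hd : ∀ x ∈ φ.source, α.d x = 0) : extDeriv (α.writtenIn φ) = 0 := by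
  funext y
  have hy : y ∈ φ.target := ht ▸ Set.mem_univ y
  have hval : α.d.val (φ.symm y) = 0 := hd _ (φ.map_target hy)
  rw [← Form.writtenIn_d hφ hy ((Form.smoothOn_iff φ.open_source).1 hα _ (φ.map_target hy)),
    Form.writtenIn, hval]
  rfl

theorem Form.exactOn_source (hφ : φ ∈ IsManifold.maximalAtlas (𝓡 n) ∞ M)
    (ht : φ.target = Set.univ) {α : Form n M (k + 1)} (hα : α.SmoothOn φ.source)
    (hd : ∀ x ∈ φ.source, α.d x = 0) : α.ExactOn φ.source := by
  obtain ⟨w, hw, hdw⟩ := exists_extDeriv_eq (Form.contDiff_writtenIn hφ ht hα)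
    (Form.extDeriv_writtenIn_eq_zero hφ ht hα hd)
  exact ⟨Form.ofModel φ w,
    (Form.smoothOn_iff φ.open_source).2 fun x hx => Form.smoothAt_ofModel hφ hw hx,
    fun x hx => Form.d_ofModel hφ hw hdw hx⟩

theorem Form.exactOn_univ_of_forall_notMem_eq_zero [T2Space M]
    (hφ : φ ∈ IsManifold.maximalAtlas (𝓡 n) ∞ M) (ht : φ.target = Set.univ) (hk : k + 1 < n)
    {α : Form n M (k + 1)} (hα : α.SmoothOn φ.source) (hd : ∀ x ∈ φ.source, α.d x = 0)
    {C : Set M} (hC : IsCompact C) (hCφ : C ⊆ φ.source) (h0 : ∀ x ∉ C, α x = 0) :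
    α.ExactOn Set.univ := by
  obtain ⟨w, hw, hdw, hsupp⟩ := exists_extDeriv_eq_of_hasCompactSupport (by simpa using hk)
    (Form.contDiff_writtenIn hφ ht hα) (Form.extDeriv_writtenIn_eq_zero hφ ht hα hd)
    (Form.hasCompactSupport_writtenIn ht hC hCφ h0)
  have hzero : ∀ x ∉ φ.source, ∀ᶠ y in 𝓝 x, (Form.ofModel φ w) y = (0 : Form n M k) y :=
    fun x hx => Form.ofModel_eventually_eq_zero hsupp (ht ▸ Set.subset_univ _) hx
  refine ⟨Form.ofModel φ w, (Form.smoothOn_iff isOpen_univ).2 fun x _ => ?_, fun x _ => ?_⟩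
  · by_cases hx : x ∈ φ.source
    · exact Form.smoothAt_ofModel hφ hw hx
    · exact (Form.smoothAt_zero x).congr ((hzero x hx).mono fun _ => Eq.symm)
  · by_cases hx : x ∈ φ.source
    · exact Form.d_ofModel hφ hw hdw hx
    · rw [Form.d_congr (hzero x hx), Form.d_zero, h0 x fun h => hx (hCφ h)]
      rfl

end ChartOntoModel

section Gluing

variable {n : ℕ} {M : Type*} [TopologicalSpace M] [ChartedSpace (EuclideanSpace ℝ (Fin n)) M]
  {k : ℕ} {s t : Set M}

theorem Form.SmoothOn.sub {α η : Form n M k} (hα : α.SmoothOn s) (hη : η.SmoothOn s) :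
    (α - η).SmoothOn s := fun x₀ => (hα x₀).sub (hη x₀)

theorem Form.d_sub {α η : Form n M k} (hs : IsOpen s) (hα : α.SmoothOn s)
    (hη : η.SmoothOn s) {x : M} (hx : x ∈ s) : (α - η).d x = α.d x - η.d x := by
  rw [eq_sub_iff_add_eq, ← Form.d_add hs (hα.sub hη) hη hx, sub_add_cancel]

theorem Form.d_eq_of_eqOn {α β : Form n M k} (hs : IsOpen s) (h : ∀ x ∈ s, α x = β x) {x : M}
    (hx : x ∈ s) : α.d x = β.d x :=
  Form.d_congr (Filter.mem_of_superset (hs.mem_nhds hx) h)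

theorem Form.ExactOn.congr {α β : Form n M k} (hα : α.ExactOn s) (h : ∀ x ∈ s, α x = β x) :
    β.ExactOn s := by
  cases k with
  | zero => exact fun x hx => (h x hx).symm.trans (hα x hx)
  | succ k => exact hα.imp fun ν hν => ⟨hν.1, fun x hx => (hν.2 x hx).trans (h x hx)⟩

variable [IsManifold (𝓡 n) ∞ M]

theorem Form.SmoothOn.congr {α β : Form n M k} (hs : IsOpen s) (hα : α.SmoothOn s)
    (h : ∀ x ∈ s, α x = β x) : β.SmoothOn s :=
  (Form.smoothOn_iff hs).2 fun x hx =>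
    ((Form.smoothOn_iff hs).1 hα x hx).congr (Filter.mem_of_superset (hs.mem_nhds hx) h)

theorem Form.SmoothOn.union {α : Form n M k} (hs : IsOpen s) (ht : IsOpen t)
    (hαs : α.SmoothOn s) (hαt : α.SmoothOn t) : α.SmoothOn (s ∪ t) :=
  (Form.smoothOn_iff (hs.union ht)).2 fun x hx =>
    hx.elim ((Form.smoothOn_iff hs).1 hαs x) ((Form.smoothOn_iff ht).1 hαt x)

open Classical in
theorem Form.ExactOn.union_of_disjoint {α : Form n M (k + 1)} (hs : IsOpen s) (ht : IsOpen t)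
    (hst : Disjoint s t) (hαs : α.ExactOn s) (hαt : α.ExactOn t) : α.ExactOn (s ∪ t) := by
  obtain ⟨ν, hν, hdν⟩ := hαs
  obtain ⟨μ, hμ, hdμ⟩ := hαt
  let ρ : Form n M k := s.piecewise ν μ
  have hρs : ∀ x ∈ s, ν x = ρ x := fun x hx => (s.piecewise_eq_of_mem ν μ hx).symm
  have hρt : ∀ x ∈ t, μ x = ρ x := fun x hx =>
    (s.piecewise_eq_of_notMem ν μ (Set.disjoint_right.1 hst hx)).symm
  refine ⟨ρ, (hν.congr hs hρs).union hs ht (hμ.congr ht hρt), ?_⟩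
  rintro x (hx | hx)
  · rw [← Form.d_eq_of_eqOn hs hρs hx, hdν x hx]
  · rw [← Form.d_eq_of_eqOn ht hρt hx, hdμ x hx]

theorem Form.SmoothOn.univ_of_eventually_eq_zero {α : Form n M k} (hs : IsOpen s)
    (hα : α.SmoothOn s) (h0 : ∀ᶠ x in 𝓝ˢ sᶜ, α x = 0) : α.SmoothOn Set.univ := by
  refine (Form.smoothOn_iff isOpen_univ).2 fun x _ => ?_
  by_cases hx : x ∈ s
  · exact (Form.smoothOn_iff hs).1 hα x hx
  · exact (Form.smoothAt_zero x).congr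
      ((eventually_nhdsSet_iff_forall.1 h0 x hx).mono fun _ => Eq.symm)

theorem mem_closedForms_of_eventually_eq_zero {α : Form n M k} (hs : IsOpen s)
    (hα : α.SmoothOn s) (hd : ∀ x ∈ s, α.d x = 0) (h0 : ∀ᶠ x in 𝓝ˢ sᶜ, α x = 0) :
    α ∈ closedForms n M k := by
  refine ⟨hα.univ_of_eventually_eq_zero hs h0, funext fun x => ?_⟩
  by_cases hx : x ∈ s
  · exact hd x hx
  · have hαx : ∀ᶠ y in 𝓝 x, α y = (0 : Form n M k) y := eventually_nhdsSet_iff_forall.1 h0 x hx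
    rw [Form.d_congr hαx, Form.d_zero]

end Gluing

section Cutoff

variable {n : ℕ} {M : Type*} [TopologicalSpace M] [ChartedSpace (EuclideanSpace ℝ (Fin n)) M]
  [IsManifold (𝓡 n) ∞ M] {k : ℕ} {K U W : Set M}

/-- The product of a form with a function. -/
def Form.fsmul (χ : M → ℝ) (α : Form n M k) : Form n M k := fun x => χ x • α x

theorem Form.SmoothAt.fsmul {χ : M → ℝ} {α : Form n M k} {x : M} (hα : α.SmoothAt x)
    (hχ : ContMDiffAt (𝓡 n) 𝓘(ℝ, ℝ) ∞ χ x) : (α.fsmul χ).SmoothAt x := by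
  have hx := mem_chart_source (Model n) x
  have hχ' : ContMDiffAt 𝓘(ℝ, Model n) 𝓘(ℝ, ℝ) ∞ (χ ∘ (chartAt (Model n) x).symm)
      (chartAt (Model n) x x) :=
    hχ.comp_of_eq (contMDiffAt_symm_of_mem_maximalAtlas (chartAt_mem_maximalAtlas x)
      ((chartAt (Model n) x).map_source hx)) ((chartAt (Model n) x).left_inv hx)
  exact ContDiffAt.smul (f := χ ∘ (chartAt (Model n) x).symm) hχ'.contDiffAt hα

variable [T2Space M]

theorem exists_contMDiff_eventually_eq_one (hK : IsCompact K) (hW : IsOpen W) (hKW : K ⊆ W) :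
    ∃ (χ : M → ℝ) (C : Set M), ContMDiff (𝓡 n) 𝓘(ℝ, ℝ) ∞ χ ∧ IsCompact C ∧ C ⊆ W ∧
      (∀ x ∉ C, χ x = 0) ∧ ∀ᶠ x in 𝓝ˢ K, χ x = 1 := by
  refine hK.induction_on (p := fun s => ∃ (χ : M → ℝ) (C : Set M), ContMDiff (𝓡 n) 𝓘(ℝ, ℝ) ∞ χ ∧
    IsCompact C ∧ C ⊆ W ∧ (∀ x ∉ C, χ x = 0) ∧ ∀ᶠ x in 𝓝ˢ s, χ x = 1) ?_ ?_ ?_ fun x hx => ?_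
  · exact ⟨0, ∅, contMDiff_const, isCompact_empty, W.empty_subset, fun _ _ => rfl, by simp⟩
  · rintro s t hst ⟨χ, C, hχ, hC, hCW, hχ0, hχ1⟩
    exact ⟨χ, C, hχ, hC, hCW, hχ0, hχ1.filter_mono (nhdsSet_mono hst)⟩
  · rintro s t ⟨χ, C, hχ, hC, hCW, hχ0, hχ1⟩ ⟨χ', C', hχ', hC', hCW', hχ0', hχ1'⟩
    refine ⟨fun x => 1 - (1 - χ x) * (1 - χ' x), C ∪ C', ?_, hC.union hC',
      Set.union_subset hCW hCW', fun x hx => ?_, ?_⟩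
    · exact contMDiff_const.sub ((contMDiff_const.sub hχ).mul (contMDiff_const.sub hχ'))
    · rw [Set.mem_union, not_or] at hx
      simp [hχ0 x hx.1, hχ0' x hx.2]
    · rw [nhdsSet_union, Filter.eventually_sup]
      exact ⟨hχ1.mono fun x hx => by simp [hx], hχ1'.mono fun x hx => by simp [hx]⟩
  · obtain ⟨χ, -, hχW⟩ := (SmoothBumpFunction.nhds_basis_tsupport (I := 𝓡 n) x).mem_iff.1
      (hW.mem_nhds (hKW hx))
    refine ⟨{y | ∀ᶠ z in 𝓝 y, χ z = 1},
      mem_nhdsWithin_of_mem_nhds (eventually_eventually_nhds.2 χ.eventuallyEq_one), χ, tsupport χ,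
      χ.contMDiff, χ.hasCompactSupport, hχW, fun _ => image_eq_zero_of_notMem_tsupport,
      eventually_nhdsSet_iff_forall.2 fun _ hy => hy⟩

theorem Form.SmoothOn.exists_cutoff (hU : IsOpen U) (hUc : IsCompact Uᶜ) (hW : IsOpen W)
    (hUW : Uᶜ ⊆ W) {ν : Form n M k} (hν : ν.SmoothOn (W ∩ U)) :
    ∃ (ζ : Form n M k) (C : Set M), ζ.SmoothOn U ∧ IsCompact C ∧ C ⊆ W ∧
      (∀ x ∉ C, ζ x = 0) ∧ ∀ᶠ x in 𝓝ˢ Uᶜ, ζ x = ν x := by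
  obtain ⟨χ, C, hχ, hC, hCW, hχ0, hχ1⟩ := exists_contMDiff_eventually_eq_one (n := n) hUc hW hUW
  have hζ0 : ∀ x ∉ C, ν.fsmul χ x = 0 := fun x hx => by
    rw [Form.fsmul, hχ0 x hx, zero_smul]
  refine ⟨ν.fsmul χ, C, (Form.smoothOn_iff hU).2 fun x hx => ?_, hC, hCW, hζ0,
    hχ1.mono fun x hx => by rw [Form.fsmul, hx, one_smul]⟩
  by_cases hxW : x ∈ W
  · exact ((Form.smoothOn_iff (hW.inter hU)).1 hν x ⟨hxW, hx⟩).fsmul hχ.contMDiffAt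
  · refine (Form.smoothAt_zero x).congr ?_
    filter_upwards [hC.isClosed.isOpen_compl.mem_nhds fun hxC => hxW (hCW hxC)] with y hy
    exact (hζ0 y hy).symm

end Cutoff

section Extension

variable {n : ℕ} {M : Type*} [TopologicalSpace M] [ChartedSpace (EuclideanSpace ℝ (Fin n)) M]
  [IsManifold (𝓡 n) ∞ M] [T2Space M] {k : ℕ} {U : Set M}

open Classical in
theorem exists_extension_exactAtInfinity (hU : IsOpen U) (hUc : IsCompact Uᶜ)
    {α : Form n M (k + 1)} (hα : α.SmoothOn U) (hd : ∀ x ∈ U, α.d x = 0) {L : Set M}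
    (hL : IsCompact L) (hLU : L ⊆ U) (hex : α.ExactOn (Lᶜ ∩ U)) :
    ∃ β ∈ closedFormsExactAtInfinity n M (k + 1), (α - β).ExactOn U := by
  obtain ⟨ν, hν, hdν⟩ := hex
  have hLc : IsOpen Lᶜ := hL.isClosed.isOpen_compl
  have hUL : Uᶜ ⊆ Lᶜ := Set.compl_subset_compl.2 hLU
  obtain ⟨ζ, C, hζ, hC, -, hζ0, hζν⟩ := hν.exists_cutoff hU hUc hLc hUL
  let β : Form n M (k + 1) := U.piecewise (α - ζ.d) 0
  have hβU : ∀ x ∈ U, (α - ζ.d) x = β x := fun x hx => (U.piecewise_eq_of_mem _ _ hx).symm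
  have hβ0 : ∀ᶠ x in 𝓝ˢ Uᶜ, β x = 0 := by
    filter_upwards [hζν.eventually_nhdsSet, hLc.mem_nhdsSet.2 hUL] with x hx hxL
    by_cases hxU : x ∈ U
    · exact (hβU x hxU).symm.trans
        (sub_eq_zero.2 ((hdν x ⟨hxL, hxU⟩).symm.trans (Form.d_congr hx).symm))
    · exact U.piecewise_eq_of_notMem _ _ hxU
  have hβd : ∀ x ∈ U, β.d x = 0 := fun x hx => by
    rw [← Form.d_eq_of_eqOn hU hβU hx, Form.d_sub hU hα (hζ.d hU) hx, hd x hx,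
      Form.d_d (hζ.eventually_smoothAt hU hx), sub_zero]
  have hβα : ∀ x ∈ (L ∪ C ∪ Uᶜ)ᶜ, α x = β x := fun x hx => by
    simp only [Set.mem_compl_iff, Set.mem_union, not_or, not_not] at hx
    have hdζ : ζ.d x = 0 := by
      rw [Form.d_eq_of_eqOn (β := 0) hC.isClosed.isOpen_compl hζ0 hx.1.2, Form.d_zero]
      rfl
    exact (sub_eq_self.2 hdζ).symm.trans (hβU x hx.2)
  have hsub : (L ∪ C ∪ Uᶜ)ᶜ ⊆ Lᶜ ∩ U := fun x hx =>
    ⟨fun h => hx (Or.inl (Or.inl h)), by_contra fun h => hx (Or.inr h)⟩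
  have hexact : α.ExactOn (Lᶜ ∩ U) := ⟨ν, hν, hdν⟩
  refine ⟨β, ⟨mem_closedForms_of_eventually_eq_zero hU ((hα.sub (hζ.d hU)).congr hU hβU) hβd hβ0,
    L ∪ C ∪ Uᶜ, (hL.union hC).union hUc, (hexact.mono hsub).congr hβα⟩, ζ, hζ, fun x hx => ?_⟩
  exact (sub_sub_cancel (α x) (ζ.d x)).symm.trans (congrArg (α x - ·) (hβU x hx))

variable {φ : OpenPartialHomeomorph M (Model n)}

theorem exists_isCompact_exactOn_compl (hφ : φ ∈ IsManifold.maximalAtlas (𝓡 n) ∞ M)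
    (ht : φ.target = Set.univ) (hUc : IsCompact Uᶜ) (hUφ : Uᶜ ⊆ φ.source) {α : Form n M (k + 1)}
    (hα : α ∈ closedFormsExactAtInfinity n M (k + 1)) :
    ∃ L ⊆ U, IsCompact L ∧ α.ExactOn Lᶜ := by
  have : LocallyCompactSpace M := ChartedSpace.locallyCompactSpace (EuclideanSpace ℝ (Fin n)) M
  obtain ⟨⟨hs, hd⟩, L, hL, hex⟩ := hα
  obtain ⟨C, hC, hUC, hCφ⟩ := exists_compact_between hUc φ.open_source hUφ
  have hinterior : α.ExactOn (interior C) :=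
    (Form.exactOn_source hφ ht (hs.mono (Set.subset_univ _)) fun x _ => congrFun hd x).mono
      (interior_subset.trans hCφ)
  have hcompl : α.ExactOn (L ∪ C)ᶜ := hex.mono (Set.compl_subset_compl.2 Set.subset_union_left)
  have hdisjoint : Disjoint (interior C) (L ∪ C)ᶜ :=
    Set.disjoint_left.2 fun x hx hx' => hx' (Or.inr (interior_subset hx))
  refine ⟨(L ∪ C) \ interior C, fun x hx => by_contra fun hxU => hx.2 (hUC hxU),
    (hL.union hC).diff isOpen_interior, ?_⟩
  rw [Set.compl_sdiff]
  exact hinterior.union_of_disjoint isOpen_interior (hL.union hC).isClosed.isOpen_compl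
    hdisjoint hcompl

theorem exactOn_univ_of_exactOn_of_isCompact_compl
    (hφ : φ ∈ IsManifold.maximalAtlas (𝓡 n) ∞ M) (ht : φ.target = Set.univ) (hk : k + 1 < n)
    (hU : IsOpen U) (hUc : IsCompact Uᶜ) (hUφ : Uᶜ ⊆ φ.source) {α : Form n M (k + 1)}
    (hα : α ∈ closedForms n M (k + 1)) (hex : α.ExactOn U) : α.ExactOn Set.univ := by
  obtain ⟨hs, hd⟩ := hα
  obtain ⟨ν, hν, hdν⟩ := hex
  obtain ⟨ζ, C, hζ, hC, hCφ, hζ0, hζν⟩ :=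
    (hν.mono Set.inter_subset_right).exists_cutoff hU hUc φ.open_source hUφ
  have hμ : (ν - ζ).SmoothOn Set.univ := (hν.sub hζ).univ_of_eventually_eq_zero hU
    (hζν.mono fun x hx => sub_eq_zero.2 hx.symm)
  have hμd := hμ.d isOpen_univ
  have hclosed : ∀ x, (α - (ν - ζ).d).d x = 0 := fun x => by
    rw [Form.d_sub isOpen_univ hs hμd (Set.mem_univ x), hd,
      Form.d_d (hμ.eventually_smoothAt isOpen_univ (Set.mem_univ x))]
    exact sub_zero _
  have hsupp : ∀ x ∉ C ∪ Uᶜ, (α - (ν - ζ).d) x = 0 := fun x hx => by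
    simp only [Set.mem_compl_iff, Set.mem_union, not_or, not_not] at hx
    have hdμ : (ν - ζ).d x = ν.d x := Form.d_eq_of_eqOn hC.isClosed.isOpen_compl
      (fun y hy => sub_eq_self.2 (hζ0 y hy)) hx.1
    exact sub_eq_zero.2 ((hdν x hx.2).symm.trans hdμ.symm)
  have hremainder : (α - (ν - ζ).d).ExactOn Set.univ :=
    Form.exactOn_univ_of_forall_notMem_eq_zero hφ ht hk
      ((hs.sub hμd).mono (Set.subset_univ _)) (fun x _ => hclosed x) (hC.union hUc)
      (Set.union_subset hCφ hUφ) hsupp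
  have hsum := hremainder.add isOpen_univ (η := (ν - ζ).d) ⟨_, hμ, fun _ _ => rfl⟩
  rwa [sub_add_cancel] at hsum

end Extension

section Restriction

open TopologicalSpace (Opens)

variable {n : ℕ} {M : Type*} [TopologicalSpace M] [ChartedSpace (EuclideanSpace ℝ (Fin n)) M]
  {k : ℕ} {U : Opens M}

/-- The restriction of forms to an open submanifold, whose tangent spaces are by definition those of
the ambient manifold. -/
def Form.restrict (U : Opens M) : Form n M k →ₗ[ℝ] Form n U k where
  toFun α := fun x => α.val x
  map_add' _ _ := rfl
  map_smul' _ _ := rfl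

open Classical in
/-- The extension by zero of a form on an open submanifold, a set-theoretic inverse of restriction
which is in general not smooth. -/
def Form.extend (η : Form n U k) : Form n M k :=
  fun x => if h : x ∈ U then η.val ⟨x, h⟩ else (0 : Model n [⋀^Fin k]→L[ℝ] ℝ)

theorem Form.restrict_extend (η : Form n U k) : Form.restrict U η.extend = η :=
  funext fun x => dif_pos x.2

theorem coe_chartAt_symm_apply (x : U) {y : Model n} (hy : y ∈ (chartAt (Model n) x).target) :
    ((chartAt (Model n) x).symm y : M) = (chartAt (Model n) (x : M)).symm y :=
  (chartAt (Model n) (x : M)).subtypeRestr_symm_apply ⟨x⟩ hy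

theorem mfderiv_subtypeVal (x : U) :
    mfderiv (𝓡 n) (𝓡 n) (Subtype.val : U → M) x = ContinuousLinearMap.id ℝ (Model n) := by
  refine HasMFDerivAt.mfderiv ⟨continuous_subtype_val.continuousAt,
    HasFDerivAt.hasFDerivWithinAt ((hasFDerivAt_id _).congr_of_eventuallyEq ?_)⟩
  filter_upwards [(chartAt (Model n) x).open_target.mem_nhds (mem_chart_target _ x)] with y hy
  change chartAt (Model n) (x : M) ((chartAt (Model n) x).symm y : M) = y
  exact (chartAt (Model n) x).right_inv hy

theorem mdifferentiableAt_subtypeVal (x : U) :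
    MDifferentiableAt (𝓡 n) (𝓡 n) (Subtype.val : U → M) x :=
  contMDiff_subtype_val.mdifferentiableAt (n := ∞) (by simp)

variable [IsManifold (𝓡 n) ∞ M]

theorem mfderiv_chartAt_symm_coe (x : U) {y : Model n} (hy : y ∈ (chartAt (Model n) x).target) :
    mfderiv 𝓘(ℝ, Model n) (𝓡 n) (chartAt (Model n) (x : M)).symm y =
      mfderiv 𝓘(ℝ, Model n) (𝓡 n) (chartAt (Model n) x).symm y := by
  have heq : (chartAt (Model n) (x : M)).symm =ᶠ[𝓝 y] Subtype.val ∘ (chartAt (Model n) x).symm :=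
    Filter.mem_of_superset ((chartAt (Model n) x).open_target.mem_nhds hy)
      fun _ hz => (coe_chartAt_symm_apply x hz).symm
  rw [heq.mfderiv_eq, mfderiv_comp y (mdifferentiableAt_subtypeVal _)
    ((mdifferentiable_chart x).mdifferentiableAt_symm hy), mfderiv_subtypeVal]
  rfl

theorem mfderiv_chartAt_coe (x : U) :
    mfderiv (𝓡 n) 𝓘(ℝ, Model n) (chartAt (Model n) (x : M)) x =
      mfderiv (𝓡 n) 𝓘(ℝ, Model n) (chartAt (Model n) x) x := by
  have heq : ⇑(chartAt (Model n) x) = chartAt (Model n) (x : M) ∘ Subtype.val := rfl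
  rw [heq, mfderiv_comp x ((mdifferentiable_chart (x : M)).mdifferentiableAt
    (mem_chart_source _ _)) (mdifferentiableAt_subtypeVal x), mfderiv_subtypeVal]
  rfl

theorem Form.writtenIn_restrict (α : Form n M k) (x : U) {y : Model n}
    (hy : y ∈ (chartAt (Model n) x).target) :
    (Form.restrict U α).writtenIn (chartAt (Model n) x) y =
      α.writtenIn (chartAt (Model n) (x : M)) y := by
  have hval : (Form.restrict U α).val ((chartAt (Model n) x).symm y) =
      α.val ((chartAt (Model n) (x : M)).symm y) := by
    rw [← coe_chartAt_symm_apply x hy]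
    rfl
  rw [Form.writtenIn, hval, ← mfderiv_chartAt_symm_coe x hy, Form.writtenIn]

theorem Form.writtenIn_restrict_eventuallyEq (α : Form n M k) (x : U) :
    (Form.restrict U α).writtenIn (chartAt (Model n) x) =ᶠ[𝓝 (chartAt (Model n) x x)]
      α.writtenIn (chartAt (Model n) (x : M)) :=
  Filter.mem_of_superset ((chartAt (Model n) x).open_target.mem_nhds
    ((chartAt (Model n) x).map_source (mem_chart_source _ x))) fun _ => α.writtenIn_restrict x

theorem Form.smoothAt_restrict {α : Form n M k} {x : U} :
    (Form.restrict U α).SmoothAt x ↔ α.SmoothAt (x : M) :=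
  have heq := α.writtenIn_restrict_eventuallyEq x
  ⟨fun h => ContDiffAt.congr_of_eventuallyEq h heq.symm,
    fun h => ContDiffAt.congr_of_eventuallyEq h heq⟩

theorem Form.d_restrict (α : Form n M k) : (Form.restrict U α).d = Form.restrict U α.d := by
  funext x
  have hval : (Form.restrict U α).d.val x = (Form.restrict U α.d).val x := by
    rw [Form.val_d, (α.writtenIn_restrict_eventuallyEq x).extDeriv_eq, ← mfderiv_chartAt_coe]
    rfl
  exact hval

theorem Form.smoothOn_restrict {α : Form n M k} {s : Set M} (hs : IsOpen s) :
    (Form.restrict U α).SmoothOn (Subtype.val ⁻¹' s) ↔ α.SmoothOn (s ∩ U) := by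
  rw [Form.smoothOn_iff (hs.preimage continuous_subtype_val), Form.smoothOn_iff (hs.inter U.isOpen)]
  exact ⟨fun h x hx => Form.smoothAt_restrict.1 (h ⟨x, hx.2⟩ hx.1),
    fun h x hx => Form.smoothAt_restrict.2 (h x ⟨hx, x.2⟩)⟩

theorem Form.exactOn_restrict {α : Form n M (k + 1)} {s : Set M} (hs : IsOpen s) :
    (Form.restrict U α).ExactOn (Subtype.val ⁻¹' s) ↔ α.ExactOn (s ∩ U) := by
  constructor
  · rintro ⟨ν, hν, hdν⟩
    rw [← ν.restrict_extend, Form.smoothOn_restrict hs] at hν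
    rw [← ν.restrict_extend, Form.d_restrict] at hdν
    exact ⟨ν.extend, hν, fun x hx => hdν ⟨x, hx.2⟩ hx.1⟩
  · rintro ⟨ν, hν, hdν⟩
    refine ⟨Form.restrict U ν, (Form.smoothOn_restrict hs).2 hν, fun x hx => ?_⟩
    rw [Form.d_restrict]
    exact hdν x ⟨hx, x.2⟩

theorem Form.smoothOn_univ_restrict {α : Form n M k} :
    (Form.restrict U α).SmoothOn Set.univ ↔ α.SmoothOn U := by
  simpa only [Set.preimage_univ, Set.univ_inter] using Form.smoothOn_restrict (α := α) isOpen_univ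

theorem Form.exactOn_univ_restrict {α : Form n M (k + 1)} :
    (Form.restrict U α).ExactOn Set.univ ↔ α.ExactOn U := by
  simpa only [Set.preimage_univ, Set.univ_inter] using Form.exactOn_restrict (α := α) isOpen_univ

end Restriction

section Comparison

open TopologicalSpace (Opens)

theorem nonempty_linearEquiv_quotient_submoduleOf {R V V' : Type*} [Ring R] [AddCommGroup V]
    [Module R V] [AddCommGroup V'] [Module R V'] (f : V →ₗ[R] V') {Z B : Submodule R V}
    {Z' B' : Submodule R V'} (hmaps : ∀ v ∈ Z, f v ∈ Z') (hiff : ∀ v ∈ Z, f v ∈ B' ↔ v ∈ B)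
    (hsurj : ∀ w ∈ Z', ∃ v ∈ Z, w - f v ∈ B') :
    Nonempty ((Z ⧸ B.submoduleOf Z) ≃ₗ[R] (Z' ⧸ B'.submoduleOf Z')) := by
  let g : Z →ₗ[R] Z' ⧸ B'.submoduleOf Z' := (B'.submoduleOf Z').mkQ ∘ₗ f.restrict hmaps
  have hker : LinearMap.ker g = B.submoduleOf Z := by
    ext ⟨v, hv⟩
    exact (Submodule.Quotient.mk_eq_zero _).trans (hiff v hv)
  have hg : Function.Surjective g := by
    intro q
    obtain ⟨⟨w, hw⟩, rfl⟩ := Submodule.mkQ_surjective _ q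
    obtain ⟨v, hv, hwv⟩ := hsurj w hw
    exact ⟨⟨v, hv⟩, ((Submodule.Quotient.eq (B'.submoduleOf Z')).2 hwv).symm⟩
  rw [← hker]
  exact ⟨g.quotKerEquivOfSurjective hg⟩

variable {n : ℕ} {M : Type*} [TopologicalSpace M] [T2Space M]
  [ChartedSpace (EuclideanSpace ℝ (Fin n)) M] [IsManifold (𝓡 n) ∞ M] {k : ℕ}
  {φ : OpenPartialHomeomorph M (Model n)} {U : Opens M}

theorem restrict_mem_closedFormsExactAtInfinity (hφ : φ ∈ IsManifold.maximalAtlas (𝓡 n) ∞ M)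
    (ht : φ.target = Set.univ) (hU : IsCompact (U : Set M)ᶜ) (hUφ : (U : Set M)ᶜ ⊆ φ.source)
    {α : Form n M (k + 1)} (hα : α ∈ closedFormsExactAtInfinity n M (k + 1)) :
    Form.restrict U α ∈ closedFormsExactAtInfinity n U (k + 1) := by
  obtain ⟨L, hLU, hL, hex⟩ := exists_isCompact_exactOn_compl hφ ht hU hUφ hα
  refine ⟨⟨?_, ?_⟩, Subtype.val ⁻¹' L, ?_, ?_⟩
  · exact Form.smoothOn_univ_restrict.2 (hα.1.1.mono (Set.subset_univ _))
  · rw [Form.d_restrict, hα.1.2, map_zero]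
  · exact Topology.IsInducing.subtypeVal.isCompact_preimage' hL (Subtype.range_coe ▸ hLU)
  · exact (Form.exactOn_restrict hL.isClosed.isOpen_compl).2 (hex.mono Set.inter_subset_left)

theorem exists_sub_restrict_mem_exactForms (hU : IsCompact (U : Set M)ᶜ) {η : Form n U (k + 1)}
    (hη : η ∈ closedFormsExactAtInfinity n U (k + 1)) :
    ∃ β ∈ closedFormsExactAtInfinity n M (k + 1),
      η - Form.restrict U β ∈ exactForms n U (k + 1) := by
  obtain ⟨⟨hs, hd⟩, L, hL, hex⟩ := hη
  obtain ⟨α, rfl⟩ : ∃ α, Form.restrict U α = η := ⟨_, η.restrict_extend⟩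
  have hL' : IsCompact (Subtype.val '' L : Set M) := hL.image continuous_subtype_val
  have hLU : Subtype.val '' L ⊆ (U : Set M) := Subtype.coe_image_subset _ L
  have hdα : ∀ x ∈ U, α.d x = 0 := fun x hx => congrFun (α.d_restrict ▸ hd) ⟨x, hx⟩
  rw [← Set.preimage_image_eq L Subtype.val_injective, ← Set.preimage_compl,
    Form.exactOn_restrict hL'.isClosed.isOpen_compl] at hex
  obtain ⟨β, hβ, hαβ⟩ := exists_extension_exactAtInfinity U.isOpen hU
    (Form.smoothOn_univ_restrict.1 hs) hdα hL' hLU hex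
  refine ⟨β, hβ, ?_⟩
  rw [← map_sub]
  exact Form.exactOn_univ_restrict.2 hαβ

theorem restrict_mem_exactForms_iff (hφ : φ ∈ IsManifold.maximalAtlas (𝓡 n) ∞ M)
    (ht : φ.target = Set.univ) (hk : k + 1 < n) (hU : IsCompact (U : Set M)ᶜ)
    (hUφ : (U : Set M)ᶜ ⊆ φ.source) {α : Form n M (k + 1)} (hα : α ∈ closedForms n M (k + 1)) :
    Form.restrict U α ∈ exactForms n U (k + 1) ↔ α ∈ exactForms n M (k + 1) :=
  Form.exactOn_univ_restrict.trans
    ⟨exactOn_univ_of_exactOn_of_isCompact_compl hφ ht hk U.isOpen hU hUφ hα,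
      fun h => Form.ExactOn.mono h (Set.subset_univ _)⟩

theorem c_opens_eq_of_lt (hφ : φ ∈ IsManifold.maximalAtlas (𝓡 n) ∞ M) (ht : φ.target = Set.univ)
    (hk : k + 1 < n) (hU : IsCompact (U : Set M)ᶜ) (hUφ : (U : Set M)ᶜ ⊆ φ.source) :
    c n U (k + 1) = c n M (k + 1) := by
  obtain ⟨e⟩ := nonempty_linearEquiv_quotient_submoduleOf (Form.restrict U)
    (fun _ => restrict_mem_closedFormsExactAtInfinity hφ ht hU hUφ)
    (fun _ hα => restrict_mem_exactForms_iff hφ ht hk hU hUφ hα.1)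
    (fun _ => exists_sub_restrict_mem_exactForms hU)
  exact e.rank_eq.symm

end Comparison

section HighDegree

variable {n k : ℕ} {M : Type*} [TopologicalSpace M] [ChartedSpace (EuclideanSpace ℝ (Fin n)) M]

theorem Form.subsingleton_of_lt (hk : n < k) : Subsingleton (Form n M k) := by
  have eq_zero (f : Model n [⋀^Fin k]→L[ℝ] ℝ) : f = 0 := by
    ext v
    refine f.toAlternatingMap.map_linearDependent v fun hv => hk.not_ge ?_
    simpa only [Fintype.card_fin, finrank_euclideanSpace] using hv.fintype_card_le_finrank
  exact ⟨fun α β => funext fun x => (eq_zero (α.val x)).trans (eq_zero (β.val x)).symm⟩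

theorem c_eq_zero_of_lt [T2Space M] (hk : n < k) : c n M k = 0 := by
  have : Subsingleton (Form n M k) := Form.subsingleton_of_lt hk
  have : Subsingleton (closedFormsExactAtInfinity n M k ⧸
      (exactForms n M k).submoduleOf (closedFormsExactAtInfinity n M k)) :=
    (Submodule.mkQ_surjective _).subsingleton
  exact rank_subsingleton' ℝ _

end HighDegree

section Ball

theorem closure_symm_image_subset {X Y : Type*} [TopologicalSpace X] [T2Space X]
    [TopologicalSpace Y] (φ : OpenPartialHomeomorph X Y) {s t : Set Y} (hst : s ⊆ t)
    (ht : IsCompact t) (htφ : t ⊆ φ.target) : closure (φ.symm '' s) ⊆ φ.symm '' t :=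
  closure_minimal (Set.image_mono hst)
    (ht.image_of_continuousOn (φ.continuousOn_symm.mono htφ)).isClosed

variable {n : ℕ} {M : Type*} [TopologicalSpace M] [ChartedSpace (EuclideanSpace ℝ (Fin n)) M]
  {φ : OpenPartialHomeomorph M (Model n)} {p : Model n} {r : ℝ}

theorem trans_univBall_symm_mem_maximalAtlas [IsManifold (𝓡 n) ∞ M]
    (hφ : φ ∈ IsManifold.maximalAtlas (𝓡 n) ∞ M) (hr : 0 < r) :
    φ.trans (OpenPartialHomeomorph.univBall p r).symm ∈ IsManifold.maximalAtlas (𝓡 n) ∞ M := by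
  have hball : ContMDiff 𝓘(ℝ, Model n) 𝓘(ℝ, Model n) ∞ (OpenPartialHomeomorph.univBall p r) :=
    OpenPartialHomeomorph.contDiff_univBall.contMDiff
  have hball_symm : ContMDiffOn 𝓘(ℝ, Model n) 𝓘(ℝ, Model n) ∞
      (OpenPartialHomeomorph.univBall p r).symm (OpenPartialHomeomorph.univBall p r).target := by
    rw [OpenPartialHomeomorph.univBall_target p hr]
    exact OpenPartialHomeomorph.contDiffOn_univBall_symm.contMDiffOn
  refine OpenPartialHomeomorph.mem_maximalAtlas_of_contMDiffOn _ ?_ ?_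
  · exact hball_symm.comp ((contMDiffOn_of_mem_maximalAtlas hφ).mono fun _ hx => hx.1)
      fun _ hx => hx.2
  · exact (contMDiffOn_symm_of_mem_maximalAtlas hφ).comp hball.contMDiffOn fun _ hx => hx.2

theorem IsBall.exists_chart_onto_model [T2Space M] [IsManifold (𝓡 n) ∞ M] {B : Set M}
    (hB : IsBall n B) :
    ∃ φ ∈ IsManifold.maximalAtlas (𝓡 n) ∞ M, φ.target = Set.univ ∧ closure B ⊆ φ.source := by
  obtain ⟨φ, hφ, p, r, hr, hsub, rfl⟩ := hB
  obtain ⟨δ, hδ, hδφ⟩ := (isCompact_closedBall p r).exists_thickening_subset_open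
    φ.open_target hsub
  rw [thickening_closedBall hδ hr.le] at hδφ
  have hpos : 0 < δ + r := add_pos hδ hr
  let e := OpenPartialHomeomorph.univBall p (δ + r)
  have he : e.target = Metric.ball p (δ + r) := OpenPartialHomeomorph.univBall_target p hpos
  have hsource : e.source = Set.univ := OpenPartialHomeomorph.univBall_source p (δ + r)
  refine ⟨φ.trans e.symm, trans_univBall_symm_mem_maximalAtlas hφ hpos, ?_, ?_⟩
  · rw [OpenPartialHomeomorph.trans_target, OpenPartialHomeomorph.symm_target, hsource,
      Set.univ_inter]
    exact Set.eq_univ_of_forall fun y => hδφ (he ▸ e.map_source (hsource ▸ Set.mem_univ y))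
  · refine (closure_symm_image_subset φ Metric.ball_subset_closedBall
      (isCompact_closedBall p r) hsub).trans ?_
    rintro _ ⟨y, hy, rfl⟩
    refine ⟨φ.map_target (hsub hy), ?_⟩
    change φ (φ.symm y) ∈ e.target
    rw [φ.right_inv (hsub hy), he]
    exact Metric.closedBall_subset_ball (lt_add_of_pos_left r hδ) hy

end Ball

end DeRham

end

theorem mainTheorem8_general (n : ℕ) (M : Type*) [TopologicalSpace M] [T2Space M]
    [ChartedSpace (EuclideanSpace ℝ (Fin n)) M] [IsManifold (𝓡 n) ∞ M] (k : ℕ) (hk : 0 < k)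
    (hkn : k ≠ n) {φ : OpenPartialHomeomorph M (EuclideanSpace ℝ (Fin n))}
    (hφ : φ ∈ IsManifold.maximalAtlas (𝓡 n) ∞ M) (ht : φ.target = Set.univ)
    (U : TopologicalSpace.Opens M) (hU : IsCompact (U : Set M)ᶜ) (hUφ : (U : Set M)ᶜ ⊆ φ.source) :
    DeRham.c n U k = DeRham.c n M k := by
  obtain ⟨k, rfl⟩ := Nat.exists_eq_succ_of_ne_zero hk.ne'
  rcases hkn.lt_or_gt with hlt | hgt
  · exact DeRham.c_opens_eq_of_lt hφ ht hlt hU hUφ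
  · rw [DeRham.c_eq_zero_of_lt hgt, DeRham.c_eq_zero_of_lt hgt]

theorem mainTheorem8 (n : ℕ) (M : Type*) [TopologicalSpace M] [T2Space M]
    [SecondCountableTopology M] [ChartedSpace (EuclideanSpace ℝ (Fin n)) M]
    [IsManifold (𝓡 n) ∞ M] (k : ℕ) (hk : 0 < k) (hkn : k ≠ n)
    (B : Set M) (hB : DeRham.IsBall n B) (hBc : IsCompact (closure B)) :
    DeRham.c n (⟨(closure B)ᶜ, isClosed_closure.isOpen_compl⟩ : TopologicalSpace.Opens M) k =
      DeRham.c n M k := by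
  obtain ⟨φ, hφ, ht, hBφ⟩ := hB.exists_chart_onto_model
  exact mainTheorem8_general n M k hk hkn hφ ht _ (by simpa using hBc) (by simpa using hBφ)
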